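/- **Dual Cauchy kernel function identity for the Koornwinder--van Diejen operators.** *The function $s$.* Let $r,a>0$ and let $s$ be one of the functions $s(x)=x$ (rational case I), $s(x)=\frac1r\sin(rx)$ (trigonometric case II), $s(x)=\frac a\pi\sinh(\pi x/a)$ (hyperbolic case III), $s(x)=\frac1r e^{ra/4}\vartheta_1(rx\,|\,ira/\pi)$ (elliptic case IV), where $\vartheta_1(z|\tau)=2\sum_{n\ge0}(-1)^ne^{i\pi\tau(n+1/2)^2}\sin((2n+1)z)$. Let $\Omega$ be the set of zeros of $s$. Put $\rho=0,1,1,3$ in the cases I, II, III, IV; $\omega_0=0$; $\omega_1=\pi/r$ in II and IV, $\omega_1=ia$ in III; $\omega_2=ia$ and $\omega_3=-\omega_1-\omega_2$ in IV; $(\xi_0,\xi_1,\xi_2,\xi_3)=(0,0,-1,1)$ (only $\xi_0,\dots,\xi_\rho$ occur; the terms $r\xi_\nu$ below are $0$ in I--III); $|\omega|=\sum_{\nu=0}^\rho\omega_\nu$. *Parameters.* Let $N,M\in\mathbb Z_{\ge0}$, $\beta>0$, $\lambda\in\mathbb C$ with $\operatorname{Re}\lambda\ne0$, $g=(g_0,\dots,g_{2\rho+1})\in\mathbb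 C^{2\rho+2}$ (in particular all real $g$ and real $\lambda\neq 0$), $|g|=\sum_\nu g_\nu$. Assume that $in\beta\notin\Omega$ and $in\lambda\beta\notin\Omega$ for all integers $n\ne0$, and that $i(1-\lambda)\beta\notin\Omega$. *The Gamma function.* Let $G(x;\alpha)$ ($x,\alpha\in\mathbb C$) be any function such that for each $\alpha$ with $\operatorname{Re}\alpha\ne0$ there is a constant $c\ne0$ with $G(x+i\alpha/2;\alpha)=c\,s(x)\,G(x-i\alpha/2;\alpha)$ for all $x\notin\Omega$ (poles of $G$ are given the value $0$). *Operator and eigenfunction.* For $x\in\mathbb C^N$ and $\varepsilon=\pm$ put $$V_j^{\varepsilon}(x;g,\lambda,\beta)=\frac{\prod_{\nu=0}^{2\rho+1}s(\varepsilon x_j-ig_\nu\beta)}{s(2\varepsilon x_j)\,s(2\varepsilon x_j-i\beta)}\prod_{\delta=\pm}\prod_{k\ne j}\frac{s(x_j+\delta x_k-\varepsilon i\lambda\beta)}{s(x_j+\delta x_k)},$$ $$V^0(x;g,\lambda,\beta)=-\frac{\prod_{\nu=1}^\rho s(\frac{\omega_\nu}2)^2}{4}\sum_{\nu=0}^\rho\frac{e^{-r\xi_\nu(2\lambda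 N+|g|-\frac12(\rho+1)(\lambda+1))\beta}}{\prod_{\mu\ne\nu}s(\frac12(\omega_\nu-\omega_\mu))}\,\frac{\prod_{\mu=0}^{2\rho+1}s(\frac{\omega_\nu}2+\frac{i\beta}2-ig_\mu\beta)}{\prod_{\mu=0}^{\rho}s(\frac12(\omega_\nu-\omega_\mu+i(1-\lambda)\beta))}\prod_{\delta=\pm}\prod_{j=1}^N\frac{s(\delta x_j+\frac{\omega_\nu}2+\frac{i\beta}2-i\lambda\beta)}{s(\delta x_j+\frac{\omega_\nu}2+\frac{i\beta}2)},$$ $$H_N(x;g,\lambda,\beta)=s(i\lambda\beta)\sum_{\varepsilon=\pm}\sum_{j=1}^NV_j^{\varepsilon}(x)^{1/2}\,e^{-\varepsilon i\beta\,\partial/\partial x_j}\,V_j^{-\varepsilon}(x)^{1/2}+V^0(x;g,\lambda,\beta),$$ $$\Psi_N(x;g,\lambda,\beta)=\prod_{j=1}^N\Bigl(\frac{G(2x_j+\frac{i\beta}2;\beta)\,G(-2x_j+\frac{i\beta}2;\beta)}{\prod_{\nu}G(x_j+\frac{i\beta}2-ig_\nu\beta;\beta)\,G(-x_j+\frac{i\beta}2-ig_\nu\beta;\beta)}\Bigr)^{1/2}\prod_{j<k}\prod_{\varepsilon,\varepsilon'=\pm}\Bigl(\frac{G(\varepsilon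 x_j+\varepsilon'x_k+\frac{i\beta}2;\beta)}{G(\varepsilon x_j+\varepsilon'x_k-i\lambda\beta+\frac{i\beta}2;\beta)}\Bigr)^{1/2}.$$ Here $e^{-\varepsilon i\beta\,\partial/\partial x_j}$ is the shift $x_j\mapsto x_j-\varepsilon i\beta$. *Square roots.* Fix any square roots $s(x)^{1/2}$ and $G(x;\alpha)^{1/2}$ with $G(x+i\alpha/2;\alpha)^{1/2}=\kappa\,s(x)^{1/2}\,G(x-i\alpha/2;\alpha)^{1/2}$ for $x\notin\Omega$, where $\kappa\neq 0$ depends only on $\alpha$ ($\operatorname{Re}\alpha\ne0$); such roots exist for every $G$. All square roots above are taken factor by factor with these roots, the pair factors of $V_j^{\varepsilon}$ being written as $s(\varepsilon x_j+\delta x_k-i\lambda\beta)/s(\varepsilon x_j+\delta x_k)$, $\delta=\pm$, which leaves $V_j^\varepsilon$ unchanged because $s$ is odd. *Claim.* In the elliptic case IV assume in addition $$2\lambda(N-1)+2(M-1)+\sum_{\nu=0}^{7}g_\nu=0;$$ in the cases I--III no relation between the parameters is assumed. Then $$\tilde F_{N,M}(x,\tilde y)=\Psi_N(x;g,\lambda,\beta)\,\Psi_M(\tilde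 y;\lambda^{-1}g,1/\lambda,\lambda\beta)\prod_{j=1}^N\prod_{\delta=\pm}\prod_{k=1}^{M}s(x_j+\delta\tilde y_k)$$ satisfies $$\bigl(H_N(x;g,\lambda,\beta)+H_M(\tilde y;\lambda^{-1}g,1/\lambda,\lambda\beta)-\tilde C_{N,M}\bigr)\tilde F_{N,M}(x,\tilde y)=0,$$ $$\tilde C_{N,M}=\frac{\prod_{\nu=1}^\rho s(\frac{\omega_\nu}2)^2}{4}\,s\bigl(i\beta[2\lambda N+2M+|g|-\tfrac12(\rho+1)(\lambda+1)]-|\omega|\bigr),$$ at all $x\in\mathbb C^N$, $\tilde y\in\mathbb C^{M}$ with $x_j\pm\tilde y_k\notin\Omega$ for which no numerator or denominator factor vanishes in the coefficients $V_j^{\pm}$ occurring in the two operators, that is in $V_j^{\varepsilon}(x;g,\lambda,\beta)$ and in $V_j^{-\varepsilon}(\,\cdot\,;g,\lambda,\beta)$ at $x$ with $x_j$ replaced by $x_j-\varepsilon i\beta$, and likewise for $\tilde y$ with the parameters $(\lambda^{-1}g,1/\lambda,\lambda\beta)$. -/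

import Mathlib

open Complex

noncomputable section

namespace VanDiejen

/-- The odd Jacobi theta function
`θ₁(z|τ) = -i ∑_{n ∈ ℤ} (-1)ⁿ e^{iπτ(n+1/2)²} e^{(2n+1)iz}`
(equivalently `2 ∑_{n ≥ 0} (-1)ⁿ e^{iπτ(n+1/2)²} sin((2n+1)z)`), for `Im τ > 0`. -/
def theta1 (z τ : ℂ) : ℂ :=
  -I * ∑' n : ℤ, (-1 : ℂ) ^ n * cexp (Real.pi * I * τ * (n + 1 / 2) ^ 2) *
    cexp ((2 * n + 1) * I * z)

/-- The four cases: rational (I), trigonometric (II), hyperbolic (III), elliptic (IV). -/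
inductive ModelCase : Type
  | rational : ModelCase
  | trigonometric (r : ℝ) (hr : 0 < r) : ModelCase
  | hyperbolic (a : ℝ) (ha : 0 < a) : ModelCase
  | elliptic (r a : ℝ) (hr : 0 < r) (ha : 0 < a) : ModelCase

namespace ModelCase

/-- The proposition that the case is the elliptic one. -/
def IsElliptic : ModelCase → Prop
  | elliptic _ _ _ _ => True
  | _ => False

/-- The function `s(x)`. Its set of zeros is the period group `Ω`. -/
def s : ModelCase → ℂ → ℂ
  | rational, x => x
  | trigonometric r _, x => (1 / r) * Complex.sin (r * x)
  | hyperbolic a _, x => (a / Real.pi) * Complex.sinh (Real.pi * x / a)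
  | elliptic r a _ _, x => (1 / r) * cexp (r * a / 4) * theta1 (r * x) (I * r * a / Real.pi)

/-- The number `ρ`. -/
def rho : ModelCase → ℕ
  | rational => 0
  | trigonometric _ _ => 1
  | hyperbolic _ _ => 1
  | elliptic _ _ _ _ => 3

/-- The periods `ω_0, …, ω_ρ`. -/
def omega : (c : ModelCase) → Fin (c.rho + 1) → ℂ
  | rational => ![0]
  | trigonometric r _ => ![0, Real.pi / r]
  | hyperbolic a _ => ![0, I * a]
  | elliptic r a _ _ => ![0, Real.pi / r, I * a, -(Real.pi / r) - I * a]

/-- The numbers `r ξ_0, …, r ξ_ρ`, where `(ξ_0, ξ_1, ξ_2, ξ_3) = (0, 0, -1, 1)`. -/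
def rxi : (c : ModelCase) → Fin (c.rho + 1) → ℂ
  | rational => ![0]
  | trigonometric _ _ => ![0, 0]
  | hyperbolic _ _ => ![0, 0]
  | elliptic r _ _ _ => ![0, 0, -r, r]

/-- The constant `∏_{ν=1}^{ρ} s(ω_ν / 2)² / 4`. -/
def prefactor (c : ModelCase) : ℂ :=
  (∏ ν : Fin c.rho, c.s (c.omega ν.succ / 2) ^ 2) / 4

end ModelCase

/-- `G(x; α)` is a Gamma function: for every `α` with `Re α ≠ 0` there is `c ≠ 0` with
`G(x + iα/2; α) = c s(x) G(x - iα/2; α)`. Here `G` has the value `0` at its poles; if `s(x) ≠ 0`,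
then `x + iα/2` is a pole (a zero) if and only if `x - iα/2` is one, and the equation reads
`0 = 0` there. If `s(x) = 0`, one of the two points is a zero or a pole, and nothing is
required of the values. -/
def IsGammaFunction (c : ModelCase) (G : ℂ → ℂ → ℂ) : Prop :=
  ∀ α : ℂ, α.re ≠ 0 → ∃ κ : ℂ, κ ≠ 0 ∧ ∀ x : ℂ, c.s x ≠ 0 →
    G (x + I * α / 2) α = κ * c.s x * G (x - I * α / 2) α

/-- A consistent choice of branches of the square roots: a square root of `s` and a square root
of `G` that are linked by the square root of the functional equation of `G`. All other square
roots are built from these factor by factor. -/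
structure Branches (c : ModelCase) (G : ℂ → ℂ → ℂ) where
  /-- a square root of `s` -/
  sRoot : ℂ → ℂ
  /-- a square root of `G`, as a function of `x` and `α` -/
  gRoot : ℂ → ℂ → ℂ
  sRoot_sq : ∀ x, sRoot x ^ 2 = c.s x
  gRoot_sq : ∀ x α, gRoot x α ^ 2 = G x α
  gRoot_shift : ∀ α : ℂ, α.re ≠ 0 → ∃ κ : ℂ, κ ≠ 0 ∧ ∀ x : ℂ, c.s x ≠ 0 →
    gRoot (x + I * α / 2) α = κ * sRoot x * gRoot (x - I * α / 2) α

/-- A sign `ε = ±1` as a complex number. -/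
abbrev sgn (ε : ℤˣ) : ℂ := ((ε : ℤ) : ℂ)

/-- The point obtained from `x` by replacing `x_j` with `x_j - ε i β`, so that
`exp(-ε i β ∂/∂x_j)` maps `f` to `x ↦ f (shift β ε j x)`. -/
def shift {N : ℕ} (β : ℂ) (ε : ℤˣ) (j : Fin N) (x : Fin N → ℂ) : Fin N → ℂ :=
  Function.update x j (x j - sgn ε * I * β)

section Operator

variable (c : ModelCase) {N : ℕ} (g : Fin (2 * c.rho + 2) → ℂ) (lam β : ℂ)

/-- The coefficient `V_j^ε(x; g, λ, β)`. -/
def coeffV (ε : ℤˣ) (j : Fin N) (x : Fin N → ℂ) : ℂ :=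
  (∏ ν, c.s (sgn ε * x j - I * g ν * β)) /
      (c.s (sgn ε * (2 * x j)) * c.s (sgn ε * (2 * x j) - I * β)) *
    ∏ δ : ℤˣ, ∏ k ∈ Finset.univ.erase j,
      c.s (x j + sgn δ * x k - sgn ε * (I * lam * β)) / c.s (x j + sgn δ * x k)

/-- The square root `V_j^ε(x; g, λ, β)^{1/2}`, taken factor by factor with the root `R` of `s`.
The factors `s(x_j + δ x_k + iλβ) / s(x_j + δ x_k)` of `V_j^-` are written as
`s(-x_j - δ x_k - iλβ) / s(-x_j - δ x_k)`, so that `V_j^-` is `V_j^+` at `-x_j`. -/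
def rootV (R : ℂ → ℂ) (ε : ℤˣ) (j : Fin N) (x : Fin N → ℂ) : ℂ :=
  (∏ ν, R (sgn ε * x j - I * g ν * β)) /
      (R (sgn ε * (2 * x j)) * R (sgn ε * (2 * x j) - I * β)) *
    ∏ δ : ℤˣ, ∏ k ∈ Finset.univ.erase j,
      R (sgn ε * x j + sgn δ * x k - I * lam * β) / R (sgn ε * x j + sgn δ * x k)

/-- The potential `V^0(x; g, λ, β)`. -/
def coeffV0 (x : Fin N → ℂ) : ℂ :=
  -c.prefactor * ∑ ν,
    cexp (-c.rxi ν * (2 * lam * N + ∑ μ, g μ - (c.rho + 1) * (lam + 1) / 2) * β) /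
        (∏ μ ∈ Finset.univ.erase ν, c.s ((c.omega ν - c.omega μ) / 2)) *
      ((∏ μ, c.s (c.omega ν / 2 + I * β / 2 - I * g μ * β)) /
        ∏ μ, c.s ((c.omega ν - c.omega μ + I * (1 - lam) * β) / 2)) *
      ∏ δ : ℤˣ, ∏ j : Fin N,
        c.s (sgn δ * x j + c.omega ν / 2 + I * β / 2 - I * lam * β) /
          c.s (sgn δ * x j + c.omega ν / 2 + I * β / 2)

/-- The Koornwinder-van Diejen operator
`H_N = s(iλβ) ∑_ε ∑_j V_j^ε(x)^{1/2} exp(-ε i β ∂/∂x_j) V_j^{-ε}(x)^{1/2} + V^0(x)`,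
with the square roots given by the root `R` of `s`. -/
def operatorH (R : ℂ → ℂ) (f : (Fin N → ℂ) → ℂ) (x : Fin N → ℂ) : ℂ :=
  c.s (I * lam * β) * ∑ ε : ℤˣ, ∑ j : Fin N,
      rootV c g lam β R ε j x *
        (rootV c g lam β R (-ε) j (shift β ε j x) * f (shift β ε j x)) +
    coeffV0 c g lam β x * f x

/-- The product
`∏_j [γ(2x_j + iβ/2) γ(-2x_j + iβ/2) / ∏_ν γ(x_j + iβ/2 - i g_ν β) γ(-x_j + iβ/2 - i g_ν β)]
  · ∏_{j<k} ∏_{ε,ε'} γ(ε x_j + ε' x_k + iβ/2) / γ(ε x_j + ε' x_k - iλβ + iβ/2)`.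
For `γ = G(·; β)` this is `Ψ_N(x; g, λ, β)²`, and for `γ = G(·; β)^{1/2}` it is
`Ψ_N(x; g, λ, β)`. -/
def gammaProduct (γ : ℂ → ℂ) (x : Fin N → ℂ) : ℂ :=
  (∏ j : Fin N, γ (2 * x j + I * β / 2) * γ (-2 * x j + I * β / 2) /
      ∏ ν, γ (x j + I * β / 2 - I * g ν * β) * γ (-x j + I * β / 2 - I * g ν * β)) *
    ∏ j : Fin N, ∏ k ∈ Finset.Ioi j, ∏ ε : ℤˣ, ∏ ε' : ℤˣ,
      γ (sgn ε * x j + sgn ε' * x k + I * β / 2) /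
        γ (sgn ε * x j + sgn ε' * x k - I * lam * β + I * β / 2)

/-- The points at which the coefficients that occur in `H_N` are regular and different from zero
(the branch points of their square roots are avoided): since `z / 0 = 0` in Lean, a value
different from zero says that no factor of the numerator or of the denominator vanishes. -/
def IsRegularPoint (x : Fin N → ℂ) : Prop :=
  ∀ (ε : ℤˣ) (j : Fin N),
    coeffV c g lam β ε j x ≠ 0 ∧ coeffV c g lam β (-ε) j (shift β ε j x) ≠ 0

end Operator

/-- The function `Ψ_N(x; g, λ, β)`, with the square roots given by the branches `b`. -/
def Psi {c : ModelCase} {G : ℂ → ℂ → ℂ} (b : Branches c G) {N : ℕ}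
    (g : Fin (2 * c.rho + 2) → ℂ) (lam β : ℂ) (x : Fin N → ℂ) : ℂ :=
  gammaProduct c g lam β (fun z => b.gRoot z β) x

/-- The dual Cauchy kernel function
`F̃(x, y) = Ψ_N(x; g, λ, β) Ψ_M(y; g/λ, 1/λ, λβ) ∏_{j,k} s(x_j + y_k) s(x_j - y_k)`. -/
def dualKernel {c : ModelCase} {G : ℂ → ℂ → ℂ} (b : Branches c G) {N M : ℕ}
    (g : Fin (2 * c.rho + 2) → ℂ) (lam β : ℂ) (x : Fin N → ℂ) (y : Fin M → ℂ) : ℂ :=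
  Psi b g lam β x * Psi b (fun ν => g ν / lam) (1 / lam) (lam * β) y *
    ∏ j : Fin N, ∏ δ : ℤˣ, ∏ k : Fin M, c.s (x j + sgn δ * y k)

/-- The constant `C̃_{N,M}`. -/
def dualConstant (c : ModelCase) (N M : ℕ) (g : Fin (2 * c.rho + 2) → ℂ) (lam β : ℂ) : ℂ :=
  c.prefactor * c.s (I * β * (2 * lam * N + 2 * M + ∑ ν, g ν - (c.rho + 1) * (lam + 1) / 2) -
    ∑ ν, c.omega ν)

/-! Proved facts that relate the definitions above to each other. -/

theorem theta1_eq_jacobiTheta₂ (z τ : ℂ) :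
    theta1 z τ = -I * cexp (Real.pi * I * τ / 4 + I * z) *
      jacobiTheta₂ (z / Real.pi + τ / 2 + 1 / 2) τ := by
  have hpi : (Real.pi : ℂ) ≠ 0 := by exact_mod_cast Real.pi_ne_zero
  have h0 : cexp (Real.pi * I * τ / 4 + I * z) * jacobiTheta₂ (z / Real.pi + τ / 2 + 1 / 2) τ =
      ∑' n : ℤ, cexp (Real.pi * I * τ / 4 + I * z) *
        jacobiTheta₂_term n (z / Real.pi + τ / 2 + 1 / 2) τ := by
    rw [jacobiTheta₂, tsum_mul_left]
  rw [theta1, mul_assoc (-I) (cexp _), h0]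
  congr 1
  refine tsum_congr fun n => ?_
  have h1 : ((-1 : ℂ)) ^ n = cexp (Real.pi * I * n) := by
    rw [← Complex.exp_pi_mul_I, ← Complex.exp_int_mul]; congr 1; ring
  rw [h1, jacobiTheta₂_term, ← Complex.exp_add, ← Complex.exp_add, ← Complex.exp_add]
  congr 1
  field_simp
  ring

theorem theta1_neg (z τ : ℂ) : theta1 (-z) τ = -theta1 z τ := by
  unfold theta1
  rw [← mul_neg]
  congr 1
  rw [← Equiv.tsum_eq (Equiv.subLeft (-1 : ℤ)) (fun n : ℤ => (-1 : ℂ) ^ n *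
    cexp (Real.pi * I * τ * (n + 1 / 2) ^ 2) * cexp ((2 * n + 1) * I * -z)), ← tsum_neg]
  refine tsum_congr fun n => ?_
  have h1 : ((-1 : ℂ)) ^ (-1 - n : ℤ) = -(-1) ^ n := by
    rw [show (-1 - n : ℤ) = -(n + 1) by ring, zpow_neg, zpow_add₀ (by norm_num)]
    rcases Int.even_or_odd n with h | h
    · simp [h.neg_one_zpow]
    · simp [h.neg_one_zpow]
  simp only [Equiv.subLeft_apply, h1]
  push_cast
  rw [show ((-1 - n + 1 / 2 : ℂ)) ^ 2 = (n + 1 / 2) ^ 2 by ring,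
    show (2 * (-1 - n : ℂ) + 1) * I * -z = (2 * n + 1) * I * z by ring]
  ring

theorem ModelCase.s_neg (c : ModelCase) (x : ℂ) : c.s (-x) = -c.s x := by
  cases c <;> simp [ModelCase.s, Complex.sin_neg, neg_div, Complex.sinh_neg, theta1_neg]

/-- The factor-by-factor root is a square root of `V_j^ε`. -/
theorem rootV_sq {c : ModelCase} {G : ℂ → ℂ → ℂ} (b : Branches c G) {N : ℕ}
    (g : Fin (2 * c.rho + 2) → ℂ) (lam β : ℂ) (ε : ℤˣ) (j : Fin N) (x : Fin N → ℂ) :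
    rootV c g lam β b.sRoot ε j x ^ 2 = coeffV c g lam β ε j x := by
  have hs := c.s_neg
  simp only [rootV, coeffV, mul_pow, div_pow, ← Finset.prod_pow, b.sRoot_sq]
  congr 1
  rcases Int.units_eq_one_or ε with rfl | rfl
  · simp [sgn]
  · rw [← Equiv.prod_comp (Equiv.neg ℤˣ)]
    refine Finset.prod_congr rfl fun δ _ => Finset.prod_congr rfl fun k _ => ?_
    have h1 : sgn (-1) * x j + sgn (Equiv.neg ℤˣ δ) * x k - I * lam * β =
        -(x j + sgn δ * x k - sgn (-1) * (I * lam * β)) := by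
      simp [sgn]; ring
    have h2 : sgn (-1) * x j + sgn (Equiv.neg ℤˣ δ) * x k = -(x j + sgn δ * x k) := by
      simp [sgn]; ring
    rw [h1, h2, hs, hs, neg_div_neg_eq]

/-- `Ψ_N` is a square root of the product of Gamma functions. -/
theorem Psi_sq {c : ModelCase} {G : ℂ → ℂ → ℂ} (b : Branches c G) {N : ℕ}
    (g : Fin (2 * c.rho + 2) → ℂ) (lam β : ℂ) (x : Fin N → ℂ) :
    Psi b g lam β x ^ 2 = gammaProduct c g lam β (fun z => G z β) x := by
  simp only [Psi, gammaProduct, mul_pow, div_pow, ← Finset.prod_pow, b.gRoot_sq]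

theorem exists_sign_function (w : ℂ) (hw : w ≠ 0) (τ : ℂ → ℂ) (hτ : ∀ z, τ z ^ 2 = 1) :
    ∃ σ : ℂ → ℂ, (∀ z, σ z ^ 2 = 1) ∧ ∀ z, σ (z + w) = σ z * τ z := by
  let T : ℂ → ℤ → ℂ := fun z n => match n with
    | Int.ofNat n => ∏ i ∈ Finset.range n, τ (z + i * w)
    | Int.negSucc n => ∏ i ∈ Finset.range (n + 1), τ (z - (i + 1) * w)
  have hT2 : ∀ z n, T z n ^ 2 = 1 := by
    intro z n
    cases n <;> simp [T, ← Finset.prod_pow, hτ]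
  have hT : ∀ z (n : ℤ), T z (n + 1) = T z n * τ (z + n * w) := by
    intro z n
    rcases n with n | n
    · change ∏ i ∈ Finset.range (n + 1), τ (z + i * w) = _
      simp [T, Finset.prod_range_succ]
    · have key : T z (Int.negSucc n) = T z (Int.negSucc n + 1) * τ (z - (n + 1) * w) := by
        rcases n with _ | n
        · change ∏ i ∈ Finset.range (0 + 1), τ (z - (i + 1) * w) =
            (∏ i ∈ Finset.range 0, τ (z + i * w)) * _
          simp
        · change ∏ i ∈ Finset.range (n + 1 + 1), τ (z - (i + 1) * w) =
            (∏ i ∈ Finset.range (n + 1), τ (z - (i + 1) * w)) * _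
          rw [Finset.prod_range_succ]
      rw [key, mul_assoc, Int.cast_negSucc, show (z + -((n + 1 : ℕ) : ℂ) * w) =
        z - (n + 1) * w by push_cast; ring, ← sq, hτ, mul_one]
  refine ⟨fun z => T (z - ⌊(z / w).re⌋ * w) ⌊(z / w).re⌋, fun z => hT2 _ _, fun z => ?_⟩
  have h1 : ⌊((z + w) / w).re⌋ = ⌊(z / w).re⌋ + 1 := by
    rw [add_div, div_self hw, Complex.add_re, Complex.one_re, Int.floor_add_one]
  simp only [h1]
  rw [show z + w - ((⌊(z / w).re⌋ + 1 : ℤ) : ℂ) * w = z - ⌊(z / w).re⌋ * w by push_cast; ring, hT]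
  congr 2
  ring

/-- Every Gamma function admits a consistent choice of branches. -/
theorem nonempty_branches (c : ModelCase) (G : ℂ → ℂ → ℂ) (hG : IsGammaFunction c G) :
    Nonempty (Branches c G) := by
  have hsq : ∀ z : ℂ, ∃ p : ℂ, p ^ 2 = z := fun z => IsAlgClosed.exists_pow_nat_eq z two_pos
  choose q hq using hsq
  have main : ∀ α : ℂ, ∃ Γ : ℂ → ℂ, (∀ x, Γ x ^ 2 = G x α) ∧ (α.re ≠ 0 → ∃ κ : ℂ, κ ≠ 0 ∧
      ∀ x, c.s x ≠ 0 → Γ (x + I * α / 2) = κ * q (c.s x) * Γ (x - I * α / 2)) := by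
    intro α
    by_cases hα : α.re = 0
    · exact ⟨fun x => q (G x α), fun x => hq _, fun h => absurd hα h⟩
    obtain ⟨κ, hκ, hfe⟩ := hG α hα
    have hα0 : α ≠ 0 := fun h => hα (by simp [h])
    have hw : I * α ≠ 0 := mul_ne_zero I_ne_zero hα0
    have hfe' : ∀ x, c.s (x + I * α / 2) ≠ 0 →
        q (G (x + I * α) α) ^ 2 = (q κ * q (c.s (x + I * α / 2)) * q (G x α)) ^ 2 := by
      intro x hx
      have := hfe _ hx
      rw [show x + I * α / 2 + I * α / 2 = x + I * α by ring,
        show x + I * α / 2 - I * α / 2 = x by ring] at this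
      rw [mul_pow, mul_pow, hq, hq, hq, hq, this]
    have hex : ∀ x, ∃ t : ℂ, t ^ 2 = 1 ∧ (c.s (x + I * α / 2) ≠ 0 →
        t * q (G (x + I * α) α) = q κ * q (c.s (x + I * α / 2)) * q (G x α)) := by
      intro x
      by_cases hx : c.s (x + I * α / 2) = 0
      · exact ⟨1, by simp, fun h => absurd hx h⟩
      rcases sq_eq_sq_iff_eq_or_eq_neg.mp (hfe' x hx) with h | h
      · exact ⟨1, by simp, fun _ => by rw [one_mul, h]⟩
      · exact ⟨-1, by simp, fun _ => by rw [h]; ring⟩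
    choose τ hτ hτ' using hex
    obtain ⟨σ, hσ, hσ'⟩ := exists_sign_function (I * α) hw τ hτ
    refine ⟨fun x => σ x * q (G x α), fun x => by rw [mul_pow, hσ, hq, one_mul], fun _ =>
      ⟨q κ, fun h => hκ (by rw [← hq κ, h]; simp), fun x hx => ?_⟩⟩
    have h1 : x + I * α / 2 = x - I * α / 2 + I * α := by ring
    have h2 : x - I * α / 2 + I * α / 2 = x := by ring
    have h3 := hτ' (x - I * α / 2) (by rwa [h2])
    rw [h2] at h3
    simp only [h1]
    rw [hσ', mul_assoc, h3]
    ring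
  choose Γ h1 h2 using main
  exact ⟨⟨fun x => q (c.s x), fun x α => Γ α x, fun x => hq _, fun x α => h1 α x,
    fun α hα => h2 α hα⟩⟩

/-- In the rational case, Euler's Gamma function gives the Gamma function
`G(x; α) = Γ(1/2 + x/(iα))`. -/
theorem isGammaFunction_rational :
    IsGammaFunction ModelCase.rational (fun x α => Complex.Gamma (1 / 2 + x / (I * α))) := by
  intro α hα
  have hα0 : α ≠ 0 := fun h => hα (by simp [h])
  refine ⟨1 / (I * α), by simp [hα0], fun x hx => ?_⟩
  have hx' : x ≠ 0 := hx
  have h : x / (I * α) ≠ 0 := div_ne_zero hx' (mul_ne_zero I_ne_zero hα0)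
  have e1 : 1 / 2 + (x + I * α / 2) / (I * α) = x / (I * α) + 1 := by
    field_simp; ring
  have e2 : 1 / 2 + (x - I * α / 2) / (I * α) = x / (I * α) := by
    field_simp; ring
  simp only [e1, e2, Complex.Gamma_add_one _ h, ModelCase.s]
  ring

end VanDiejen

end

open VanDiejen

/-! The function Ψ gauges away the square roots. Shifting one coordinate multiplies Ψ, through the
functional equation of G, by exactly the ratio of the two roots in that term of H
(`rootV_neg_mul_gammaProduct_shift`). Applied to the kernel function, each operator therefore acts
as multiplication by the meromorphic expression `kernelQuotient`: the coefficients V times ratios of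
values of s, plus V^0 (`operatorH_kernel`). What remains is an identity between products of values
of s.

That identity is a residue theorem. Put A = iβ and B = iλβ, and consider the quotient of products of
s(z - ·) with poles at ±x_j, ±y_k, (A + ω_ν)/2, (B + ω_ν)/2 and zeros at B ∓ x_j, A ∓ y_k, ig_νβ.
Its residues at ±x_j are, by the duplication formula for s, the shift terms of the operator in x;
those at (A + ω_ν)/2 are the terms of V^0, because reflection at a half period collapses the
y-factors to an exponential. The other half of the residues belongs to the operator in y, since the
dual parameters exchange A with B and fix ig_νβ (`source_identity`,
`kernelQuotient_eq_sum_residue`).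

The residue theorem itself (`sum_residue`) is algebraic: the residues sum to s(∑ poles - ∑ zeros),
where in the elliptic case the argument must be zero. It follows by induction on the number of poles
from one fact about s: s(x + y)s(x - y) is a 2 × 2 minor f(x)h(y) - h(x)f(y), with h = 1 outside the
elliptic case (`exists_s_add_mul_s_sub`). The elliptic balancing relation makes that argument zero
and also matches the exponentials in V^0. Superfluous genericity assumptions are removed by
continuity, as the zeros of s are isolated. -/

namespace VanDiejen

/-! ### Series identities for the theta function -/

/-- The general term of the theta series whose even and odd parts occur in the addition formula
for `theta1`. -/
noncomputable def thetaTerm (τ x : ℂ) (p : ℤ) : ℂ :=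
  cexp (Real.pi * I * τ * p ^ 2 / 2 + 2 * I * p * x)

theorem summable_thetaTerm_even {τ : ℂ} (hτ : 0 < τ.im) (x : ℂ) :
    Summable fun k : ℤ => thetaTerm τ x (2 * k) := by
  have hpi : (Real.pi : ℂ) ≠ 0 := by exact_mod_cast Real.pi_ne_zero
  have h := (summable_jacobiTheta₂_term_iff (2 * x / Real.pi) (2 * τ)).mpr (by simpa using hτ)
  refine h.congr fun k => ?_
  rw [jacobiTheta₂_term, thetaTerm]
  congr 1
  push_cast
  field_simp
  ring

theorem summable_thetaTerm_odd {τ : ℂ} (hτ : 0 < τ.im) (x : ℂ) :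
    Summable fun k : ℤ => thetaTerm τ x (2 * k + 1) := by
  have hpi : (Real.pi : ℂ) ≠ 0 := by exact_mod_cast Real.pi_ne_zero
  have h := (summable_jacobiTheta₂_term_iff (2 * x / Real.pi + τ) (2 * τ)).mpr (by simpa using hτ)
  refine (h.mul_left (cexp (Real.pi * I * τ / 2 + 2 * I * x))).congr fun k => ?_
  rw [jacobiTheta₂_term, thetaTerm, ← Complex.exp_add]
  congr 1
  push_cast
  field_simp
  ring

theorem summable_theta1 {τ : ℂ} (hτ : 0 < τ.im) (z : ℂ) :
    Summable fun n : ℤ => (-1 : ℂ) ^ n * cexp (Real.pi * I * τ * (n + 1 / 2) ^ 2) *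
      cexp ((2 * n + 1) * I * z) := by
  have hpi : (Real.pi : ℂ) ≠ 0 := by exact_mod_cast Real.pi_ne_zero
  have h := (summable_jacobiTheta₂_term_iff (z / Real.pi + τ / 2 + 1 / 2) τ).mpr hτ
  refine (h.mul_left (cexp (Real.pi * I * τ / 4 + I * z))).congr fun n => ?_
  have h1 : ((-1 : ℂ)) ^ n = cexp (Real.pi * I * n) := by
    rw [← Complex.exp_pi_mul_I, ← Complex.exp_int_mul]; congr 1; ring
  rw [h1, jacobiTheta₂_term, ← Complex.exp_add, ← Complex.exp_add, ← Complex.exp_add]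
  congr 1
  field_simp
  ring

/-- A double series over `ℤ × ℤ`, split according to the parity of `m + n`. -/
theorem hasSum_prod_of_parity {F : ℤ × ℤ → ℂ} {a b : ℂ}
    (ha : HasSum (fun p : ℤ × ℤ => F (p.1 + p.2, p.1 - p.2 - 1)) a)
    (hb : HasSum (fun p : ℤ × ℤ => F (p.1 + p.2, p.1 - p.2)) b) : HasSum F (a + b) := by
  have i1 : Function.Injective fun p : ℤ × ℤ => (p.1 + p.2, p.1 - p.2 - 1) := by
    rintro ⟨k, l⟩ ⟨k', l'⟩ h
    simp only [Prod.mk.injEq] at h ⊢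
    omega
  have i2 : Function.Injective fun p : ℤ × ℤ => (p.1 + p.2, p.1 - p.2) := by
    rintro ⟨k, l⟩ ⟨k', l'⟩ h
    simp only [Prod.mk.injEq] at h ⊢
    omega
  refine (i1.hasSum_range_iff.2 ha).add_isCompl ?_ (i2.hasSum_range_iff.2 hb)
  rw [isCompl_iff, Set.disjoint_iff, codisjoint_iff]
  constructor
  · rintro ⟨m, n⟩ ⟨⟨⟨k, l⟩, h⟩, ⟨⟨k', l'⟩, h'⟩⟩
    simp only [Prod.mk.injEq] at h h'
    exfalso
    omega
  · refine Set.eq_univ_of_forall ?_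
    rintro ⟨m, n⟩
    rcases Int.emod_two_eq_zero_or_one (m + n) with h | h
    · right
      refine ⟨⟨(m + n) / 2, m - (m + n) / 2⟩, ?_⟩
      simp only [Prod.mk.injEq]
      omega
    · left
      refine ⟨⟨(m + n + 1) / 2, m - (m + n + 1) / 2⟩, ?_⟩
      simp only [Prod.mk.injEq]
      omega

/-- In the double series over (m, n) the quadratic form (m + 1/2)² + (n + 1/2)² becomes diagonal in
the sum and difference of the indices. The two parities of m + n then give the two products, with
opposite signs. -/
theorem theta1_add_mul_theta1_sub {τ : ℂ} (hτ : 0 < τ.im) (x y : ℂ) :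
    theta1 (x + y) τ * theta1 (x - y) τ =
      (∑' k : ℤ, thetaTerm τ x (2 * k)) * (∑' k : ℤ, thetaTerm τ y (2 * k + 1)) -
      (∑' k : ℤ, thetaTerm τ x (2 * k + 1)) * (∑' k : ℤ, thetaTerm τ y (2 * k)) := by
  have hm : ∀ {u v : ℤ → ℂ}, Summable u → Summable v →
      HasSum (fun p : ℤ × ℤ => u p.1 * v p.2) ((∑' k, u k) * ∑' k, v k) := fun hu hv => by
    rw [tsum_mul_tsum_of_summable_norm hu.norm hv.norm]
    exact (summable_mul_of_summable_norm hu.norm hv.norm).hasSum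
  have h1 := hm (summable_theta1 hτ (x + y)) (summable_theta1 hτ (x - y))
  have h2 := (hm (summable_thetaTerm_even hτ x) (summable_thetaTerm_odd hτ y)).neg
  have h3 := hm (summable_thetaTerm_odd hτ x) (summable_thetaTerm_even hτ y)
  have hc : ∀ a b c d e f : ℂ, a * b * c * (d * e * f) = a * d * (b * c * (e * f)) := by
    intros; ring
  have h4 := hasSum_prod_of_parity
    (F := fun p : ℤ × ℤ => ((-1 : ℂ) ^ p.1 * cexp (Real.pi * I * τ * (p.1 + 1 / 2) ^ 2) *
      cexp ((2 * p.1 + 1) * I * (x + y))) * ((-1 : ℂ) ^ p.2 *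
      cexp (Real.pi * I * τ * (p.2 + 1 / 2) ^ 2) * cexp ((2 * p.2 + 1) * I * (x - y))))
    (h2.congr_fun ?_) (h3.congr_fun ?_)
  · have h5 := h1.unique h4
    rw [theta1, theta1, mul_mul_mul_comm, h5]
    linear_combination (-((∑' k : ℤ, thetaTerm τ x (2 * k)) * (∑' k : ℤ, thetaTerm τ y (2 * k + 1))) +
      (∑' k : ℤ, thetaTerm τ x (2 * k + 1)) * (∑' k : ℤ, thetaTerm τ y (2 * k))) * I_mul_I
  · rintro ⟨k, l⟩
    dsimp only
    have h6 : ((-1 : ℂ)) ^ (k + l) * (-1) ^ (k - l - 1) = -1 := by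
      rw [← zpow_add₀ (by norm_num), Odd.neg_one_zpow ⟨k - 1, by ring⟩]
    rw [hc, h6, neg_one_mul, thetaTerm, thetaTerm,
      ← exp_add, ← exp_add, ← exp_add, ← exp_add]
    congr 2
    push_cast
    ring
  · rintro ⟨k, l⟩
    dsimp only
    have h6 : ((-1 : ℂ)) ^ (k + l) * (-1) ^ (k - l) = 1 := by
      rw [← zpow_add₀ (by norm_num), Even.neg_one_zpow ⟨k, by ring⟩]
    rw [hc, h6, one_mul, thetaTerm, thetaTerm,
      ← exp_add, ← exp_add, ← exp_add, ← exp_add]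
    congr 1
    push_cast
    ring

theorem theta1_add_pi (z τ : ℂ) : theta1 (z + Real.pi) τ = -theta1 z τ := by
  unfold theta1
  rw [← mul_neg, ← tsum_neg]
  congr 1
  refine tsum_congr fun n => ?_
  rw [show (2 * (n : ℂ) + 1) * I * (z + Real.pi) = (2 * n + 1) * I * z + n * (2 * Real.pi * I) +
    Real.pi * I by ring, exp_add, exp_add, exp_int_mul_two_pi_mul_I, exp_pi_mul_I]
  ring

/-- Moving the summation index by one absorbs the translation; completing the square leaves the
exponential multiplier. -/
theorem theta1_add_pi_mul (z τ : ℂ) :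
    theta1 (z + Real.pi * τ) τ = -cexp (-Real.pi * I * τ - 2 * I * z) * theta1 z τ := by
  unfold theta1
  rw [mul_left_comm, ← tsum_mul_left (a := -cexp _), ← Equiv.tsum_eq (Equiv.addRight (1 : ℤ)) (fun n : ℤ =>
    -cexp (-Real.pi * I * τ - 2 * I * z) * ((-1 : ℂ) ^ n *
      cexp (Real.pi * I * τ * (n + 1 / 2) ^ 2) * cexp ((2 * n + 1) * I * z)))]
  congr 1
  refine tsum_congr fun n => ?_
  have hc : ∀ a b c d : ℂ, -a * (b * -1 * c * d) = b * (a * c * d) := by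
    intros; ring
  rw [Equiv.coe_addRight, zpow_add₀ (by norm_num), zpow_one, hc, mul_assoc, ← exp_add, ← exp_add,
    ← exp_add]
  congr 2
  push_cast
  ring

theorem differentiable_theta1 {τ : ℂ} (hτ : 0 < τ.im) : Differentiable ℂ fun z => theta1 z τ := by
  intro z
  simp only [theta1_eq_jacobiTheta₂]
  have h := differentiableAt_jacobiTheta₂_fst (z / Real.pi + τ / 2 + 1 / 2) hτ
  refine DifferentiableAt.mul (by fun_prop) ?_
  exact h.comp z (f := fun z : ℂ => z / Real.pi + τ / 2 + 1 / 2) (by fun_prop)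

/-! ### The function s: addition, reflection and duplication formulas -/

namespace ModelCase

section

variable (c : ModelCase)

theorem im_modulus_pos {r a : ℝ} (hr : 0 < r) (ha : 0 < a) :
    0 < (I * r * a / Real.pi : ℂ).im := by
  have h : (I * r * a / Real.pi : ℂ) = ((r * a / Real.pi : ℝ) : ℂ) * I := by
    push_cast; ring
  rw [h]
  simp only [mul_im, ofReal_re, I_im, ofReal_im, I_re]
  have := Real.pi_pos
  simp only [mul_one, mul_zero, add_zero]
  positivity

theorem differentiable_s : Differentiable ℂ c.s := by
  rcases c with _ | ⟨r, hr⟩ | ⟨a, ha⟩ | ⟨r, a, hr, ha⟩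
  · exact differentiable_id
  · unfold ModelCase.s; fun_prop
  · unfold ModelCase.s; fun_prop
  · unfold ModelCase.s
    refine Differentiable.mul (by fun_prop) ?_
    exact (differentiable_theta1 (im_modulus_pos hr ha)).comp
      (f := fun x : ℂ => (r : ℂ) * x) (by fun_prop)

theorem continuous_s : Continuous c.s := c.differentiable_s.continuous

@[simp]
theorem s_zero : c.s 0 = 0 := by
  have h := c.s_neg 0
  rw [neg_zero] at h
  linear_combination h / 2

theorem s_sub_comm (x y : ℂ) : c.s (x - y) = -c.s (y - x) := by
  rw [← c.s_neg, neg_sub]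

/-- The product `s(x + y) s(x - y)` is an alternating bilinear expression in functions of `x` and
`y`. -/
theorem exists_s_add_mul_s_sub : ∃ f h : ℂ → ℂ, (∀ x y, c.s (x + y) * c.s (x - y) =
    f x * h y - h x * f y) ∧ (¬ c.IsElliptic → ∀ x, h x = 1) := by
  rcases c with _ | ⟨r, hr⟩ | ⟨a, ha⟩ | ⟨r, a, hr, ha⟩
  -- Outside the elliptic case the second function is taken to be the constant 1. This makes the
  -- coefficients in `exists_s_mul_s_eq` add up to 1, which is why no relation between the
  -- parameters is needed there.
  · exact ⟨fun x => x ^ 2, fun _ => 1, fun x y => by simp only [ModelCase.s]; ring, fun _ _ => rfl⟩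
  · refine ⟨fun x => (1 / r) ^ 2 * sin (r * x) ^ 2, fun _ => 1, fun x y => ?_, fun _ _ => rfl⟩
    simp only [ModelCase.s, mul_add, mul_sub, sin_add, sin_sub]
    linear_combination (1 / (r : ℂ)) ^ 2 * (sin (r * x) ^ 2 * sin_sq_add_cos_sq (r * y : ℂ) -
      sin (r * y) ^ 2 * sin_sq_add_cos_sq (r * x : ℂ))
  · refine ⟨fun x => (a / Real.pi) ^ 2 * sinh (Real.pi * x / a) ^ 2, fun _ => 1, fun x y => ?_,
      fun _ _ => rfl⟩
    simp only [ModelCase.s, mul_add, mul_sub, add_div, sub_div, sinh_add, sinh_sub]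
    linear_combination ((a : ℂ) / Real.pi) ^ 2 *
      (sinh (Real.pi * x / a : ℂ) ^ 2 * cosh_sq (Real.pi * y / a : ℂ) -
      sinh (Real.pi * y / a : ℂ) ^ 2 * cosh_sq (Real.pi * x / a : ℂ))
  · set τ : ℂ := I * r * a / Real.pi with hτ
    refine ⟨fun x => ((1 / r) * cexp (r * a / 4)) ^ 2 * ∑' k : ℤ, thetaTerm τ (r * x) (2 * k),
      fun x => ∑' k : ℤ, thetaTerm τ (r * x) (2 * k + 1), fun x y => ?_, fun h => (h trivial).elim⟩
    simp only [ModelCase.s, mul_add, mul_sub]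
    linear_combination ((1 / r) * cexp (r * a / 4)) ^ 2 *
      theta1_add_mul_theta1_sub (im_modulus_pos hr ha) (r * x) (r * y)

/-- Weierstrass' three-term identity. -/
theorem s_three_term (x y u v : ℂ) :
    c.s (x + y) * c.s (x - y) * (c.s (u + v) * c.s (u - v)) -
      c.s (x + u) * c.s (x - u) * (c.s (y + v) * c.s (y - v)) +
      c.s (x + v) * c.s (x - v) * (c.s (y + u) * c.s (y - u)) = 0 := by
  obtain ⟨f, h, hs, -⟩ := c.exists_s_add_mul_s_sub
  -- In terms of 2 × 2 minors this is the Plücker relation.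
  simp only [hs]
  ring

theorem s_elliptic_add_real {r a : ℝ} (hr : 0 < r) (ha : 0 < a) (x : ℂ) :
    (elliptic r a hr ha).s (x + Real.pi / r) = -(elliptic r a hr ha).s x := by
  have hr' : (r : ℂ) ≠ 0 := by exact_mod_cast hr.ne'
  simp only [ModelCase.s]
  rw [show (r : ℂ) * (x + Real.pi / r) = r * x + Real.pi by field_simp, theta1_add_pi]
  ring

theorem s_elliptic_add_imag {r a : ℝ} (hr : 0 < r) (ha : 0 < a) (x : ℂ) :
    (elliptic r a hr ha).s (x + I * a) =
      -cexp (r * a - 2 * I * r * x) * (elliptic r a hr ha).s x := by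
  have hpi : (Real.pi : ℂ) ≠ 0 := by exact_mod_cast Real.pi_ne_zero
  simp only [ModelCase.s]
  rw [show (r : ℂ) * (x + I * a) = r * x + Real.pi * (I * r * a / Real.pi) by field_simp,
    theta1_add_pi_mul, show -(Real.pi : ℂ) * I * (I * r * a / Real.pi) - 2 * I * (r * x) =
      r * a - 2 * I * r * x by field_simp; linear_combination (-(r : ℂ) * a) * I_sq]
  ring

/-- Reflection at a nonzero half period. -/
theorem s_half_period_add (ν : Fin c.rho) (w : ℂ) :
    c.s (c.omega ν.succ / 2 + w) =
      cexp (2 * I * c.rxi ν.succ * w) * c.s (c.omega ν.succ / 2 - w) := by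
  have hpi : (Real.pi : ℂ) ≠ 0 := by exact_mod_cast Real.pi_ne_zero
  rcases c with _ | ⟨r, hr⟩ | ⟨a, ha⟩ | ⟨r, a, hr, ha⟩
  · exact ν.elim0
  · have hr' : (r : ℂ) ≠ 0 := by exact_mod_cast hr.ne'
    revert ν
    refine Fin.forall_fin_one.2 ?_
    change 1 / (r : ℂ) * sin (r * (Real.pi / r / 2 + w)) =
      cexp (2 * I * 0 * w) * (1 / (r : ℂ) * sin (r * (Real.pi / r / 2 - w)))
    rw [show (r : ℂ) * (Real.pi / r / 2 + w) = r * w + Real.pi / 2 by field_simp; ring,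
      show (r : ℂ) * (Real.pi / r / 2 - w) = Real.pi / 2 - r * w by field_simp, sin_add_pi_div_two,
      sin_pi_div_two_sub]
    simp
  · have ha' : (a : ℂ) ≠ 0 := by exact_mod_cast ha.ne'
    revert ν
    refine Fin.forall_fin_one.2 ?_
    change (a : ℂ) / Real.pi * sinh (Real.pi * (I * a / 2 + w) / a) =
      cexp (2 * I * 0 * w) * ((a : ℂ) / Real.pi * sinh (Real.pi * (I * a / 2 - w) / a))
    rw [show (Real.pi : ℂ) * (I * a / 2 + w) / a = Real.pi / 2 * I + Real.pi * w / a by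
        field_simp,
      show (Real.pi : ℂ) * (I * a / 2 - w) / a = Real.pi / 2 * I - Real.pi * w / a by
        field_simp, sinh_add, sinh_sub, sinh_mul_I, cosh_mul_I, cos_pi_div_two]
    simp
  · have h1 := s_elliptic_add_real hr ha
    have h2 := s_elliptic_add_imag hr ha
    have hodd := (elliptic r a hr ha).s_neg
    have hr' : (r : ℂ) ≠ 0 := by exact_mod_cast hr.ne'
    set S := (elliptic r a hr ha).s
    have key : ∀ ν : Fin 3, S ((![0, Real.pi / r, I * a, -(Real.pi / r) - I * a] : Fin 4 → ℂ)
        ν.succ / 2 + w) = cexp (2 * I * (![0, 0, -r, r] : Fin 4 → ℂ) ν.succ * w) *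
          S ((![0, Real.pi / r, I * a, -(Real.pi / r) - I * a] : Fin 4 → ℂ) ν.succ / 2 - w) := by
      intro ν
      fin_cases ν
      · change S (Real.pi / r / 2 + w) = cexp (2 * I * 0 * w) * S (Real.pi / r / 2 - w)
        rw [show (Real.pi / r / 2 + w : ℂ) = (w - Real.pi / r / 2) + Real.pi / r by ring, h1,
          ← hodd]
        simp
      · change S (I * a / 2 + w) = cexp (2 * I * (-r) * w) * S (I * a / 2 - w)
        rw [show (I * a / 2 + w : ℂ) = (w - I * a / 2) + I * a by ring, h2, neg_mul, ← mul_neg,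
          ← hodd]
        congr 2
        · linear_combination (r * a : ℂ) * I_sq
        · ring
      · change S ((-(Real.pi / r) - I * a) / 2 + w) =
          cexp (2 * I * r * w) * S ((-(Real.pi / r) - I * a) / 2 - w)
        rw [show ((-(Real.pi / r) - I * a) / 2 - w : ℂ) = -(((-(Real.pi / r) - I * a) / 2 + w +
          I * a) + Real.pi / r) by ring, hodd, h1, h2, neg_neg, ← mul_assoc, mul_neg, ← exp_add,
          show 2 * I * r * w + (r * a - 2 * I * r * ((-(Real.pi / r) - I * a) / 2 + w)) =
          Real.pi * I by field_simp; linear_combination (r * a : ℂ) * I_sq, exp_pi_mul_I]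
        simp
    exact key ν

/-- Reflection at a half period, for a product of two values. -/
theorem s_half_period_add_mul (ν : Fin (c.rho + 1)) (w w' : ℂ) :
    c.s (c.omega ν / 2 + w) * c.s (c.omega ν / 2 + w') = cexp (2 * I * c.rxi ν * (w + w')) *
      (c.s (c.omega ν / 2 - w) * c.s (c.omega ν / 2 - w')) := by
  -- At ω_0 = 0 reflection is oddness and costs a sign, which cancels in the product of two values;
  -- at the other half periods there is no sign.
  refine Fin.cases ?_ (fun ν => ?_) ν
  · have h0 : c.omega 0 = 0 ∧ c.rxi 0 = 0 := by
      rcases c with _ | ⟨r, hr⟩ | ⟨a, ha⟩ | ⟨r, a, hr, ha⟩ <;> exact ⟨rfl, rfl⟩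
    simp [h0.1, h0.2, c.s_neg]
  · rw [s_half_period_add, s_half_period_add, mul_add, exp_add]
    ring

theorem omega_zero : c.omega 0 = 0 := by
  rcases c with _ | ⟨r, hr⟩ | ⟨a, ha⟩ | ⟨r, a, hr, ha⟩ <;> rfl

/-- The duplication formula. -/
theorem s_two_mul (z : ℂ) : c.s (2 * z) * ∏ ν : Fin c.rho, c.s (c.omega ν.succ / 2) =
    2 * (-1) ^ c.rho * ∏ ν, c.s (z - c.omega ν / 2) := by
  have hpi : (Real.pi : ℂ) ≠ 0 := by exact_mod_cast Real.pi_ne_zero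
  rw [Fin.prod_univ_succ, omega_zero, zero_div, sub_zero]
  rcases c with _ | ⟨r, hr⟩ | ⟨a, ha⟩ | ⟨r, a, hr, ha⟩
  · change 2 * z * ∏ ν : Fin 0, _ = 2 * (-1) ^ 0 * (z * ∏ ν : Fin 0, _)
    simp
  · have hr' : (r : ℂ) ≠ 0 := by exact_mod_cast hr.ne'
    change 1 / (r : ℂ) * sin (r * (2 * z)) * ∏ ν : Fin 1, _ =
      2 * (-1) ^ 1 * ((1 / (r : ℂ) * sin (r * z)) * ∏ ν : Fin 1, _)
    rw [Fin.prod_univ_one, Fin.prod_univ_one]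
    change 1 / (r : ℂ) * sin (r * (2 * z)) * (1 / (r : ℂ) * sin (r * (Real.pi / r / 2))) =
      2 * (-1) ^ 1 * ((1 / (r : ℂ) * sin (r * z)) * (1 / (r : ℂ) * sin (r * (z - Real.pi / r / 2))))
    rw [show (r : ℂ) * (2 * z) = 2 * (r * z) by ring, sin_two_mul,
      show (r : ℂ) * (Real.pi / r / 2) = Real.pi / 2 by field_simp,
      show (r : ℂ) * (z - Real.pi / r / 2) = r * z - Real.pi / 2 by field_simp, sin_pi_div_two,
      sin_sub_pi_div_two]
    ring
  · have ha' : (a : ℂ) ≠ 0 := by exact_mod_cast ha.ne'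
    change (a : ℂ) / Real.pi * sinh (Real.pi * (2 * z) / a) * ∏ ν : Fin 1, _ =
      2 * (-1) ^ 1 * (((a : ℂ) / Real.pi * sinh (Real.pi * z / a)) * ∏ ν : Fin 1, _)
    rw [Fin.prod_univ_one, Fin.prod_univ_one]
    change (a : ℂ) / Real.pi * sinh (Real.pi * (2 * z) / a) *
        ((a : ℂ) / Real.pi * sinh (Real.pi * (I * a / 2) / a)) =
      2 * (-1) ^ 1 * (((a : ℂ) / Real.pi * sinh (Real.pi * z / a)) *
        ((a : ℂ) / Real.pi * sinh (Real.pi * (z - I * a / 2) / a)))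
    rw [show (Real.pi : ℂ) * (2 * z) / a = 2 * (Real.pi * z / a) by ring, sinh_two_mul,
      show (Real.pi : ℂ) * (I * a / 2) / a = Real.pi / 2 * I by field_simp,
      show (Real.pi : ℂ) * (z - I * a / 2) / a = Real.pi * z / a - Real.pi / 2 * I by field_simp,
      sinh_sub, sinh_mul_I, cosh_mul_I, cos_pi_div_two, sin_pi_div_two]
    ring
  · have hp := (elliptic r a hr ha).s_half_period_add
    have hodd := (elliptic r a hr ha).s_neg
    have hW := (elliptic r a hr ha).s_three_term
    set S := (elliptic r a hr ha).s
    change S (2 * z) * ∏ ν : Fin 3, S ((elliptic r a hr ha).omega ν.succ / 2) =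
      2 * (-1) ^ 3 * (S z * ∏ ν : Fin 3, S (z - (elliptic r a hr ha).omega ν.succ / 2))
    have hp' := fun ν : Fin 3 => hp ν z
    have hsum : (elliptic r a hr ha).omega (Fin.succ (0 : Fin 3)) +
        (elliptic r a hr ha).omega (Fin.succ (1 : Fin 3)) +
        (elliptic r a hr ha).omega (Fin.succ (2 : Fin 3)) = 0 := by
      change (Real.pi / r : ℂ) + I * a + (-(Real.pi / r) - I * a) = 0
      ring
    have e0 := hp' 0
    have e1 := hp' 1
    have e2 := hp' 2
    rw [Fin.prod_univ_three, Fin.prod_univ_three]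
    change S ((elliptic r a hr ha).omega (Fin.succ (0 : Fin 3)) / 2 + z) = cexp (2 * I * 0 * z) *
      S ((elliptic r a hr ha).omega (Fin.succ (0 : Fin 3)) / 2 - z) at e0
    change S ((elliptic r a hr ha).omega (Fin.succ (1 : Fin 3)) / 2 + z) =
      cexp (2 * I * (-r) * z) *
      S ((elliptic r a hr ha).omega (Fin.succ (1 : Fin 3)) / 2 - z) at e1
    change S ((elliptic r a hr ha).omega (Fin.succ (2 : Fin 3)) / 2 + z) = cexp (2 * I * r * z) *
      S ((elliptic r a hr ha).omega (Fin.succ (2 : Fin 3)) / 2 - z) at e2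
    change S (2 * z) * (S ((elliptic r a hr ha).omega (Fin.succ (0 : Fin 3)) / 2) *
      S ((elliptic r a hr ha).omega (Fin.succ (1 : Fin 3)) / 2) *
      S ((elliptic r a hr ha).omega (Fin.succ (2 : Fin 3)) / 2)) =
      2 * (-1) ^ 3 * (S z * (S (z - (elliptic r a hr ha).omega (Fin.succ (0 : Fin 3)) / 2) *
      S (z - (elliptic r a hr ha).omega (Fin.succ (1 : Fin 3)) / 2) *
      S (z - (elliptic r a hr ha).omega (Fin.succ (2 : Fin 3)) / 2)))
    generalize (elliptic r a hr ha).omega (Fin.succ (0 : Fin 3)) = p at *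
    generalize (elliptic r a hr ha).omega (Fin.succ (1 : Fin 3)) = q at *
    generalize (elliptic r a hr ha).omega (Fin.succ (2 : Fin 3)) = t at *
    obtain rfl : t = -p - q := by linear_combination hsum
    have hE : cexp (2 * I * (-r) * z) * cexp (2 * I * r * z) = 1 := by
      rw [← exp_add]; simp
    have hs : ∀ u v, S (u - v) = -S (v - u) := fun u v => by rw [← hodd, neg_sub]
    rw [mul_zero, zero_mul, exp_zero, one_mul] at e0
    -- These arguments make the first product of the three-term identity the left hand side. The
    -- other two both contain s(z) and one value for each nonzero half period, at half period plus z
    -- or z minus half period; reflection makes them equal up to sign, the exponentials at q and at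
    -- -p - q cancelling. This produces the factor 2.
    have h := hW (z + p / 4) (z - p / 4) (-p / 4) ((q - (-p - q)) / 4)
    rw [show z + p / 4 + (z - p / 4) = 2 * z by ring,
      show z + p / 4 - (z - p / 4) = p / 2 by ring,
      show -p / 4 + (q - (-p - q)) / 4 = q / 2 by ring,
      show -p / 4 - (q - (-p - q)) / 4 = (-p - q) / 2 by ring,
      show z + p / 4 + -p / 4 = z by ring,
      show z + p / 4 - -p / 4 = p / 2 + z by ring,
      show z - p / 4 + (q - (-p - q)) / 4 = q / 2 + z by ring,
      show z - p / 4 - (q - (-p - q)) / 4 = (-p - q) / 2 + z by ring,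
      show z + p / 4 + (q - (-p - q)) / 4 = z - (-p - q) / 2 by ring,
      show z + p / 4 - (q - (-p - q)) / 4 = z - q / 2 by ring,
      show z - p / 4 + -p / 4 = z - p / 2 by ring,
      show z - p / 4 - -p / 4 = z by ring, e0, e1, e2, hs (p / 2), hs (q / 2), hs (_ / 2)] at h
    linear_combination h - S z * S (z - p / 2) * S (z - q / 2) * S (z - (-p - q) / 2) * hE

/-- By the identity theorem a nonzero entire function has isolated zeros. All later passages from
generic to arbitrary arguments rest on this. -/
theorem eventually_s_ne_zero (hs : ∃ z, c.s z ≠ 0) {k : ℂ} (hk : k ≠ 0) (u : ℂ) :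
    ∀ᶠ t in nhdsWithin (0 : ℂ) {0}ᶜ, c.s (k * t + u) ≠ 0 := by
  obtain ⟨z₀, hz₀⟩ := hs
  have han : AnalyticOnNhd ℂ (fun t => c.s (k * t + u)) Set.univ :=
    (c.differentiable_s.comp (f := fun t : ℂ => k * t + u)
      (by fun_prop)).differentiableOn.analyticOnNhd isOpen_univ
  rcases (han 0 (Set.mem_univ _)).eventually_eq_zero_or_eventually_ne_zero with h0 | h0
  · have := han.eqOn_zero_of_preconnected_of_eventuallyEq_zero isPreconnected_univ
      (Set.mem_univ 0) h0 (Set.mem_univ ((z₀ - u) / k))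
    simp only [Pi.zero_apply] at this
    rw [mul_div_cancel₀ _ hk, sub_add_cancel] at this
    exact absurd this hz₀
  · exact h0

theorem exists_prod_s_ne_zero {ι : Type*} [Fintype ι] (hs : ∃ z, c.s z ≠ 0) (p : ι → ℂ) :
    ∃ z, ∏ i, c.s (z - p i) ≠ 0 := by
  obtain ⟨z, hz⟩ := (Filter.eventually_all.2 fun i =>
    c.eventually_s_ne_zero hs one_ne_zero (-p i)).exists
  refine ⟨z, Finset.prod_ne_zero_iff.2 fun i _ => ?_⟩
  simpa [sub_eq_add_neg] using hz i

/-- If one of these values were zero, the left side of the duplication formula would vanish for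
every z, while its right side does not. -/
theorem s_half_period_ne_zero (hs : ∃ z, c.s z ≠ 0) (ν : Fin c.rho) :
    c.s (c.omega ν.succ / 2) ≠ 0 := by
  intro h
  obtain ⟨z, hz⟩ := c.exists_prod_s_ne_zero hs fun ν => c.omega ν / 2
  have h1 := c.s_two_mul z
  rw [Finset.prod_eq_zero (Finset.mem_univ ν) h, mul_zero] at h1
  exact mul_ne_zero (by simp) hz h1.symm

theorem prod_s_half_period_ne_zero (hs : ∃ z, c.s z ≠ 0) :
    ∏ ν : Fin c.rho, c.s (c.omega ν.succ / 2) ≠ 0 :=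
  Finset.prod_ne_zero_iff.2 fun ν _ => c.s_half_period_ne_zero hs ν

theorem s_sub_half_period_ne_zero {z : ℂ} (hz : c.s (2 * z) ≠ 0) (hs : ∃ z, c.s z ≠ 0)
    (ν : Fin (c.rho + 1)) : c.s (z - c.omega ν / 2) ≠ 0 := by
  intro h
  have h1 := c.s_two_mul z
  rw [Finset.prod_eq_zero (Finset.mem_univ ν) h, mul_zero] at h1
  exact mul_ne_zero hz (c.prod_s_half_period_ne_zero hs) h1

/-- The sum of two different nonzero half periods is the negative of a half period. -/
theorem exists_half_period_add {ν μ : Fin c.rho} (h : ν ≠ μ) : ∃ κ : Fin c.rho,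
    c.omega ν.succ / 2 + c.omega μ.succ / 2 = -(c.omega κ.succ / 2) := by
  rcases c with _ | ⟨r, hr⟩ | ⟨a, ha⟩ | ⟨r, a, hr, ha⟩
  · exact ν.elim0
  · exact absurd (Subsingleton.elim (α := Fin 1) ν μ) h
  · exact absurd (Subsingleton.elim (α := Fin 1) ν μ) h
  · have key : ∀ ν μ : Fin 3, ν ≠ μ → ∃ κ : Fin 3,
        (![0, Real.pi / r, I * a, -(Real.pi / r) - I * a] : Fin 4 → ℂ) ν.succ / 2 +
        (![0, Real.pi / r, I * a, -(Real.pi / r) - I * a] : Fin 4 → ℂ) μ.succ / 2 =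
        -((![0, Real.pi / r, I * a, -(Real.pi / r) - I * a] : Fin 4 → ℂ) κ.succ / 2) := by
      intro ν μ hνμ
      -- Modulo 3 the indices 0, 1, 2 add up to zero, so this is the index different from ν and μ;
      -- the three nonzero periods also add up to zero.
      refine ⟨-(ν + μ), ?_⟩
      fin_cases ν <;> fin_cases μ <;> simp at hνμ ⊢ <;> ring
    exact key ν μ h

/-- This separates the poles (A + ω_ν)/2 from the poles (B + ω_μ)/2. One reflection reduces a
difference of two nonzero half periods to a single half period, where the duplication formula
decides. -/
theorem s_add_half_period_sub_ne_zero (hs : ∃ z, c.s z ≠ 0) {z : ℂ} (hz : c.s (2 * z) ≠ 0)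
    {ν μ : Fin (c.rho + 1)} : c.s (z + (c.omega ν - c.omega μ) / 2) ≠ 0 := by
  have hne : ∀ ν, c.s (z + c.omega ν / 2) ≠ 0 := fun ν => by
    rw [show z + c.omega ν / 2 = -(-z - c.omega ν / 2) by ring, c.s_neg]
    refine neg_ne_zero.2 (c.s_sub_half_period_ne_zero ?_ hs ν)
    rw [mul_neg, c.s_neg]
    exact neg_ne_zero.2 hz
  have hne' := fun ν => c.s_sub_half_period_ne_zero hz hs ν
  rcases eq_or_ne ν μ with rfl | h
  · simpa [c.omega_zero] using hne 0
  rcases Fin.eq_zero_or_eq_succ ν with rfl | ⟨ν, rfl⟩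
  · rw [c.omega_zero, zero_sub, neg_div, ← sub_eq_add_neg]
    exact hne' _
  rcases Fin.eq_zero_or_eq_succ μ with rfl | ⟨μ, rfl⟩
  · rw [c.omega_zero, sub_zero]
    exact hne _
  obtain ⟨κ, hκ⟩ := c.exists_half_period_add (ν := ν) (μ := μ) fun h' => h (by rw [h'])
  rw [show z + (c.omega ν.succ - c.omega μ.succ) / 2 = c.omega ν.succ / 2 +
    (z - c.omega μ.succ / 2) by ring, s_half_period_add, show c.omega ν.succ / 2 -
    (z - c.omega μ.succ / 2) = -(z + c.omega κ.succ / 2) by linear_combination hκ, c.s_neg]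
  exact mul_ne_zero (exp_ne_zero _) (neg_ne_zero.2 (hne _))

theorem s_half_period_sub_ne_zero (hs : ∃ z, c.s z ≠ 0) {ν μ : Fin (c.rho + 1)} (h : ν ≠ μ) :
    c.s ((c.omega ν - c.omega μ) / 2) ≠ 0 := by
  have hne := c.s_half_period_ne_zero hs
  rcases Fin.eq_zero_or_eq_succ ν with rfl | ⟨ν, rfl⟩
  · obtain ⟨μ, rfl⟩ := (Fin.eq_zero_or_eq_succ μ).resolve_left h.symm
    rw [c.omega_zero, zero_sub, neg_div, c.s_neg]
    exact neg_ne_zero.2 (hne μ)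
  rcases Fin.eq_zero_or_eq_succ μ with rfl | ⟨μ, rfl⟩
  · rw [c.omega_zero, sub_zero]
    exact hne ν
  obtain ⟨κ, hκ⟩ := c.exists_half_period_add (ν := ν) (μ := μ) fun h' => h (by rw [h'])
  rw [sub_div, sub_eq_add_neg, s_half_period_add, sub_neg_eq_add, hκ, c.s_neg]
  exact mul_ne_zero (exp_ne_zero _) (neg_ne_zero.2 (hne κ))

/-- The numbers `ξ_ν` vanish except in the elliptic case. -/
theorem rxi_mul_eq_zero {t : ℂ} (h : c.IsElliptic → t = 0) (ν : Fin (c.rho + 1)) :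
    c.rxi ν * t = 0 := by
  rcases c with _ | ⟨r, hr⟩ | ⟨a, ha⟩ | ⟨r, a, hr, ha⟩
  · have : ∀ ν : Fin 1, (![0] : Fin 1 → ℂ) ν * t = 0 := by intro ν; fin_cases ν; simp
    exact this ν
  · have : ∀ ν : Fin 2, (![0, 0] : Fin 2 → ℂ) ν * t = 0 := by intro ν; fin_cases ν <;> simp
    exact this ν
  · have : ∀ ν : Fin 2, (![0, 0] : Fin 2 → ℂ) ν * t = 0 := by intro ν; fin_cases ν <;> simp
    exact this ν
  · rw [h trivial, mul_zero]

theorem sum_omega_of_isElliptic (h : c.IsElliptic) : ∑ ν, c.omega ν = 0 := by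
  rcases c with _ | ⟨r, hr⟩ | ⟨a, ha⟩ | ⟨r, a, hr, ha⟩
  · exact h.elim
  · exact h.elim
  · exact h.elim
  · change ∑ ν : Fin 4, (![0, Real.pi / r, I * a, -(Real.pi / r) - I * a] : Fin 4 → ℂ) ν = 0
    simp [Fin.sum_univ_succ]

theorem rho_of_isElliptic (h : c.IsElliptic) : c.rho = 3 := by
  rcases c with _ | ⟨r, hr⟩ | ⟨a, ha⟩ | ⟨r, a, hr, ha⟩
  · exact h.elim
  · exact h.elim
  · exact h.elim
  · rfl

end

/-! ### The residue theorem for quotients of products of s -/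

section

variable (c : ModelCase)

/-- Two products with the same sum of zeros span all such products. -/
theorem exists_s_mul_s_eq {p q b₁ b₂ : ℂ} (hpq : c.s (p - q) ≠ 0)
    (hK : c.s (p + q - (b₁ + b₂)) ≠ 0) : ∃ A B : ℂ,
    (∀ z, c.s (z - b₁) * c.s (z - b₂) = A * (c.s (z - q) * c.s (z - (b₁ + b₂ - q))) +
      B * (c.s (z - p) * c.s (z - (b₁ + b₂ - p)))) ∧ (¬ c.IsElliptic → A + B = 1) := by
  obtain ⟨f, h, hfh, h1⟩ := c.exists_s_add_mul_s_sub
  have hs : ∀ z u v : ℂ, u + v = b₁ + b₂ → c.s (z - u) * c.s (z - v) =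
      f (z - (b₁ + b₂) / 2) * h ((u - v) / 2) - h (z - (b₁ + b₂) / 2) * f ((u - v) / 2) := by
    intro z u v huv
    rw [← hfh, mul_comm]
    congr 2 <;> linear_combination -huv / 2
  have hPQ : c.s (p - q) * c.s (p + q - (b₁ + b₂)) =
      f (p - (b₁ + b₂) / 2) * h (q - (b₁ + b₂) / 2) -
        h (p - (b₁ + b₂) / 2) * f (q - (b₁ + b₂) / 2) := by
    rw [← hfh, mul_comm]
    congr 2 <;> ring
  have hD := mul_ne_zero hpq hK
  -- The coefficients are forced by z = p, where the second product vanishes, and by z = q, where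
  -- the first one does.
  refine ⟨c.s (p - b₁) * c.s (p - b₂) / (c.s (p - q) * c.s (p + q - (b₁ + b₂))),
    -(c.s (q - b₁) * c.s (q - b₂)) / (c.s (p - q) * c.s (p + q - (b₁ + b₂))), fun z => ?_,
    fun he => ?_⟩
  · rw [div_mul_eq_mul_div, div_mul_eq_mul_div, ← add_div, eq_div_iff hD, hPQ, hs z b₁ b₂ rfl,
      hs p b₁ b₂ rfl, hs q b₁ b₂ rfl, hs z q _ (by ring), hs z p _ (by ring),
      show (q - (b₁ + b₂ - q)) / 2 = q - (b₁ + b₂) / 2 by ring,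
      show (p - (b₁ + b₂ - p)) / 2 = p - (b₁ + b₂) / 2 by ring]
    ring
  -- With h = 1 the terms at b₁, b₂ drop out of the sum of the numerators, which becomes f(p - ·) -
  -- f(q - ·), the common denominator.
  · rw [← add_div, div_eq_one_iff_eq hD, hPQ, hs p b₁ b₂ rfl, hs q b₁ b₂ rfl]
    simp only [h1 he]
    ring

variable {ι : Type*} [DecidableEq ι]

/-- The residue at `a i` of `z ↦ ∏ j ∈ S, s(z - b j) / s(z - a j)`, up to the factor `s'(0)`. -/
noncomputable def residue (S : Finset ι) (a b : ι → ℂ) (i : ι) : ℂ :=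
  (∏ j ∈ S, c.s (a i - b j)) / ∏ j ∈ S.erase i, c.s (a i - a j)

/-- A partial fraction step. Expanding s(z - b p)s(z - b q) by `exists_s_mul_s_eq` with the two
poles a p, a q splits the quotient into two: in one the pole a q cancels, in the other a p. Both
have the original difference between the sums of poles and zeros, so the induction hypotheses give
the same value twice, with weights A and B. Either that value is zero (elliptic case) or A + B = 1.
-/
theorem sum_residue_insert {R : Finset ι} {p q : ι} (hp : p ∉ R) (hq : q ∉ R) (hpq : p ≠ q)
    {a b : ι → ℂ} (ha : ∀ i ∈ insert p (insert q R), ∀ j ∈ insert p (insert q R), i ≠ j →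
      c.s (a i - a j) ≠ 0)
    (hb : c.IsElliptic → ∑ i ∈ insert p (insert q R), a i = ∑ i ∈ insert p (insert q R), b i)
    (hK : c.s (a p + a q - (b p + b q)) ≠ 0)
    (h1 : ∀ b' : ι → ℂ, (c.IsElliptic → ∑ i ∈ insert p R, a i = ∑ i ∈ insert p R, b' i) →
      ∑ i ∈ insert p R, c.residue (insert p R) a b' i =
        c.s (∑ i ∈ insert p R, a i - ∑ i ∈ insert p R, b' i))
    (h2 : ∀ b' : ι → ℂ, (c.IsElliptic → ∑ i ∈ insert q R, a i = ∑ i ∈ insert q R, b' i) →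
      ∑ i ∈ insert q R, c.residue (insert q R) a b' i =
        c.s (∑ i ∈ insert q R, a i - ∑ i ∈ insert q R, b' i)) :
    ∑ i ∈ insert p (insert q R), c.residue (insert p (insert q R)) a b i =
      c.s (∑ i ∈ insert p (insert q R), a i - ∑ i ∈ insert p (insert q R), b i) := by
  have hp' : p ∉ insert q R := by simp [hp, hpq]
  have hapq : c.s (a p - a q) ≠ 0 := ha p (by simp) q (by simp) hpq
  have haqp : c.s (a q - a p) ≠ 0 := ha q (by simp) p (by simp) hpq.symm
  obtain ⟨A, B, hAB, hAB1⟩ := c.exists_s_mul_s_eq hapq hK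
  -- After the cancellation of one pole a single zero is left of the two; its position keeps ∑ a - ∑
  -- b unchanged.
  set b' := Function.update b p (b p + b q - a q) with hb'
  set b'' := Function.update b q (b p + b q - a p) with hb''
  have eb'p : b' p = b p + b q - a q := by simp [hb']
  have eb''q : b'' q = b p + b q - a p := by simp [hb'']
  have eb' : ∀ i ∈ R, b' i = b i := fun i hi => by
    rw [hb', Function.update_of_ne]; rintro rfl; exact hp hi
  have eb'' : ∀ i ∈ R, b'' i = b i := fun i hi => by
    rw [hb'', Function.update_of_ne]; rintro rfl; exact hq hi
  have sR' : ∑ i ∈ R, b' i = ∑ i ∈ R, b i := Finset.sum_congr rfl eb'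
  have sR'' : ∑ i ∈ R, b'' i = ∑ i ∈ R, b i := Finset.sum_congr rfl eb''
  have pR' : ∀ z, ∏ i ∈ R, c.s (z - b' i) = ∏ i ∈ R, c.s (z - b i) := fun z =>
    Finset.prod_congr rfl fun i hi => by rw [eb' i hi]
  have pR'' : ∀ z, ∏ i ∈ R, c.s (z - b'' i) = ∏ i ∈ R, c.s (z - b i) := fun z =>
    Finset.prod_congr rfl fun i hi => by rw [eb'' i hi]
  have e1 : ∑ i ∈ insert p R, a i - ∑ i ∈ insert p R, b' i =
      ∑ i ∈ insert p (insert q R), a i - ∑ i ∈ insert p (insert q R), b i := by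
    simp only [Finset.sum_insert hp, Finset.sum_insert hq, Finset.sum_insert hp', sR', eb'p]
    ring
  have e2 : ∑ i ∈ insert q R, a i - ∑ i ∈ insert q R, b'' i =
      ∑ i ∈ insert p (insert q R), a i - ∑ i ∈ insert p (insert q R), b i := by
    simp only [Finset.sum_insert hq, Finset.sum_insert hp', sR'', eb''q]
    ring
  have h1' := h1 b' fun he => sub_eq_zero.1 (by rw [e1, hb he, sub_self])
  have h2' := h2 b'' fun he => sub_eq_zero.1 (by rw [e2, hb he, sub_self])
  rw [e1] at h1'
  rw [e2] at h2'
  have hfin : A * ∑ i ∈ insert p R, c.residue (insert p R) a b' i +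
      B * ∑ i ∈ insert q R, c.residue (insert q R) a b'' i =
      c.s (∑ i ∈ insert p (insert q R), a i - ∑ i ∈ insert p (insert q R), b i) := by
    rw [h1', h2']
    by_cases he : c.IsElliptic
    · rw [hb he]; simp
    · rw [← add_mul, hAB1 he, one_mul]
  rw [← hfin, Finset.sum_insert hp', Finset.sum_insert hq, Finset.sum_insert hp,
    Finset.sum_insert hq]
  have tp : c.residue (insert p (insert q R)) a b p = A * c.residue (insert p R) a b' p := by
    have := hAB (a p)
    rw [sub_self, s_zero, zero_mul, mul_zero, add_zero] at this
    rw [residue, residue, Finset.erase_insert hp', Finset.erase_insert hp, Finset.prod_insert hp',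
      Finset.prod_insert hq, Finset.prod_insert hq, Finset.prod_insert hp, pR', eb'p, ← mul_assoc,
      this]
    field_simp
  have tq : c.residue (insert p (insert q R)) a b q = B * c.residue (insert q R) a b'' q := by
    have := hAB (a q)
    rw [sub_self, s_zero, zero_mul, mul_zero, zero_add] at this
    rw [residue, residue, Finset.erase_insert_of_ne hpq, Finset.erase_insert hq,
      Finset.prod_insert hp', Finset.prod_insert hq, Finset.prod_insert hq, Finset.prod_insert hp,
      pR'', eb''q, ← mul_assoc, this]
    field_simp
  have tR : ∀ i ∈ R, c.residue (insert p (insert q R)) a b i =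
      A * c.residue (insert p R) a b' i + B * c.residue (insert q R) a b'' i := by
    intro i hi
    have hip : i ≠ p := by rintro rfl; exact hp hi
    have hiq : i ≠ q := by rintro rfl; exact hq hi
    have g1 : c.s (a i - a p) ≠ 0 := ha i (by simp [hi]) p (by simp) hip
    have g2 : c.s (a i - a q) ≠ 0 := ha i (by simp [hi]) q (by simp) hiq
    have n1 : p ∉ R.erase i := fun h => hp (Finset.mem_of_mem_erase h)
    have n2 : q ∉ R.erase i := fun h => hq (Finset.mem_of_mem_erase h)
    have n3 : p ∉ insert q (R.erase i) := by simp [n1, hpq]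
    have := hAB (a i)
    rw [residue, residue, residue, Finset.erase_insert_of_ne hip.symm,
      Finset.erase_insert_of_ne hip.symm, Finset.erase_insert_of_ne hiq.symm,
      Finset.prod_insert hp', Finset.prod_insert hq, Finset.prod_insert hq, Finset.prod_insert hp,
      pR', pR'', Finset.prod_insert n3, Finset.prod_insert n2, Finset.prod_insert n1, eb'p, eb''q, ← mul_assoc, this]
    field_simp
  rw [tp, tq, Finset.sum_congr rfl tR, Finset.sum_add_distrib, ← Finset.mul_sum, ← Finset.mul_sum]
  ring

/-- The sum of the residues. -/
theorem sum_residue (hs : ∃ z, c.s z ≠ 0) (a : ι → ℂ) (n : ℕ) : ∀ (S : Finset ι), S.card = n →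
    (∀ i ∈ S, ∀ j ∈ S, i ≠ j → c.s (a i - a j) ≠ 0) → ∀ b : ι → ℂ,
    (c.IsElliptic → ∑ i ∈ S, a i = ∑ i ∈ S, b i) →
    ∑ i ∈ S, c.residue S a b i = c.s (∑ i ∈ S, a i - ∑ i ∈ S, b i) := by
  induction n with
  | zero =>
    intro S hS _ b _
    rw [Finset.card_eq_zero] at hS
    simp [hS]
  | succ n ih =>
    intro S hS ha b hb
    obtain ⟨p, S', hp, rfl, hS'⟩ := Finset.card_eq_succ.1 hS
    rcases n with _ | n
    · rw [Finset.card_eq_zero] at hS'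
      simp [hS', residue]
    obtain ⟨q, R, hq, rfl, hR⟩ := Finset.card_eq_succ.1 hS'
    have hpq : p ≠ q := by rintro rfl; simp at hp
    have hpR : p ∉ R := fun h => hp (by simp [h])
    have hstep : ∀ b : ι → ℂ, (c.IsElliptic → ∑ i ∈ insert p (insert q R), a i =
        ∑ i ∈ insert p (insert q R), b i) → c.s (a p + a q - (b p + b q)) ≠ 0 →
        ∑ i ∈ insert p (insert q R), c.residue (insert p (insert q R)) a b i =
        c.s (∑ i ∈ insert p (insert q R), a i - ∑ i ∈ insert p (insert q R), b i) :=
      fun b hb hK => c.sum_residue_insert hpR hq hpq ha hb hK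
        (ih _ (by rw [Finset.card_insert_of_notMem hpR, hR]) fun i hi j hj => ha i (by
          simp only [Finset.mem_insert] at hi ⊢; tauto) j (by
          simp only [Finset.mem_insert] at hj ⊢; tauto))
        (ih _ (by rw [Finset.card_insert_of_notMem hq, hR]) fun i hi j hj => ha i (by
          simp only [Finset.mem_insert] at hi ⊢; tauto) j (by
          simp only [Finset.mem_insert] at hj ⊢; tauto))
    -- The expansion requires s(a p + a q - b p - b q) ≠ 0. Moving the zeros along e changes this
    -- argument at unit speed and preserves the elliptic balance, so the claim follows by continuity
    -- from t ≠ 0 near 0.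
    by_cases hdir : ∃ e : ι → ℂ, e p + e q = -1 ∧
        (c.IsElliptic → ∑ i ∈ insert p (insert q R), e i = 0)
    · obtain ⟨e, he1, he2⟩ := hdir
      have hcs := c.continuous_s
      have hl : Continuous fun t : ℂ => ∑ i ∈ insert p (insert q R),
          c.residue (insert p (insert q R)) a (fun j => b j + t * e j) i := by
        unfold residue
        fun_prop
      have hr : Continuous fun t : ℂ => c.s (∑ i ∈ insert p (insert q R), a i -
          ∑ i ∈ insert p (insert q R), (b i + t * e i)) := by
        fun_prop
      have hev : ∀ᶠ t in nhdsWithin (0 : ℂ) {0}ᶜ, ∑ i ∈ insert p (insert q R),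
          c.residue (insert p (insert q R)) a (fun j => b j + t * e j) i =
          c.s (∑ i ∈ insert p (insert q R), a i -
            ∑ i ∈ insert p (insert q R), (b i + t * e i)) := by
        filter_upwards [c.eventually_s_ne_zero hs one_ne_zero (a p + a q - (b p + b q))] with t ht
        refine hstep _ (fun hE => ?_) ?_
        · rw [Finset.sum_add_distrib, ← Finset.mul_sum, he2 hE, mul_zero, add_zero, hb hE]
        · convert ht using 2
          linear_combination -t * he1
      have := tendsto_nhds_unique_of_eventuallyEq
        ((hl.tendsto 0).mono_left nhdsWithin_le_nhds) ((hr.tendsto 0).mono_left nhdsWithin_le_nhds)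
        hev
      simpa using this
    -- Such a direction is missing only in the elliptic case with exactly two poles: otherwise the
    -- motion of b q is either unconstrained or can be compensated at a third index k.
    · have hE : c.IsElliptic := by
        by_contra hE
        exact hdir ⟨fun i => if i = q then -1 else 0, by simp [hpq], fun h => absurd h hE⟩
      have hR0 : R = ∅ := by
        by_contra hne
        obtain ⟨k, hk⟩ := Finset.nonempty_of_ne_empty hne
        have hkq : k ≠ q := by rintro rfl; exact hq hk
        have hkp : k ≠ p := by rintro rfl; exact hpR hk
        refine hdir ⟨fun i => (if i = q then -1 else 0) + if i = k then 1 else 0, ?_, fun _ => ?_⟩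
        · simp [hpq, hkq.symm, hkp.symm]
        · rw [Finset.sum_add_distrib]
          simp [hk]
      -- With two poles and a p + a q = b p + b q, oddness of s makes the two residues cancel.
      subst hR0
      have hb' := hb hE
      rw [Finset.sum_insert hp, Finset.sum_insert hq, Finset.sum_insert hp,
        Finset.sum_insert hq, Finset.sum_empty, Finset.sum_empty, add_zero, add_zero] at hb'
      rw [hb hE, sub_self, s_zero, Finset.sum_insert hp, Finset.sum_insert hq, Finset.sum_empty,
        residue, residue, Finset.erase_insert hp, Finset.erase_insert_of_ne hpq,
        Finset.erase_insert hq]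
      have hapq : c.s (a p - a q) ≠ 0 := ha p (by simp) q (by simp) hpq
      rw [insert_empty_eq] at hp ⊢
      rw [Finset.prod_insert hp, Finset.prod_insert hp]
      simp only [insert_empty_eq, Finset.prod_singleton]
      rw [c.s_sub_comm (a q) (a p), show a q - b p = -(a p - b q) by linear_combination hb',
        show a q - b q = -(a p - b p) by linear_combination hb', c.s_neg, c.s_neg]
      field_simp
      ring

end

/-! ### The source identity: residues at the particle positions and half periods -/

section

variable (c : ModelCase)

/-- The conditional factor replaces `Finset.erase`, so that products over a disjoint union of index
types split into blocks. -/
theorem sum_residue_univ {ι : Type*} [Fintype ι] [DecidableEq ι] (hs : ∃ z, c.s z ≠ 0)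
    (a b : ι → ℂ) (ha : ∀ i j, i ≠ j → c.s (a i - a j) ≠ 0)
    (hb : c.IsElliptic → ∑ i, a i = ∑ i, b i) :
    ∑ i, (∏ j, c.s (a i - b j)) / ∏ j, (if j = i then 1 else c.s (a i - a j)) =
      c.s (∑ i, a i - ∑ i, b i) := by
  rw [← c.sum_residue hs a _ Finset.univ rfl (fun i _ j _ => ha i j) b hb]
  refine Finset.sum_congr rfl fun i _ => ?_
  rw [residue]
  congr 1
  rw [← Finset.mul_prod_erase _ _ (Finset.mem_univ i), if_pos rfl, one_mul]
  exact Finset.prod_congr rfl fun j hj => if_neg (Finset.ne_of_mem_erase hj)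

variable {N M : ℕ} (h : Fin (2 * c.rho + 2) → ℂ) (A B : ℂ)

/-- The residue at the point `ε x_j`. -/
noncomputable def residueAtPoint (x : Fin N → ℂ) (y : Fin M → ℂ) (p : Fin N × ℤˣ) : ℂ :=
  ((∏ q : Fin N × ℤˣ, c.s (sgn p.2 * x p.1 - (B - sgn q.2 * x q.1))) *
    ((∏ q : Fin M × ℤˣ, c.s (sgn p.2 * x p.1 - (A - sgn q.2 * y q.1))) *
      ∏ ν, c.s (sgn p.2 * x p.1 - h ν))) /
  ((∏ q : Fin N × ℤˣ, if q = p then 1 else c.s (sgn p.2 * x p.1 - sgn q.2 * x q.1)) *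
    ((∏ q : Fin M × ℤˣ, c.s (sgn p.2 * x p.1 - sgn q.2 * y q.1)) *
      ((∏ ν, c.s (sgn p.2 * x p.1 - (A + c.omega ν) / 2)) *
        ∏ ν, c.s (sgn p.2 * x p.1 - (B + c.omega ν) / 2))))

/-- The residue at the shifted half period `(A + ω_ν) / 2`. -/
noncomputable def residueAtHalfPeriod (x : Fin N → ℂ) (y : Fin M → ℂ) (ν : Fin (c.rho + 1)) : ℂ :=
  ((∏ q : Fin N × ℤˣ, c.s ((A + c.omega ν) / 2 - (B - sgn q.2 * x q.1))) *
    ((∏ q : Fin M × ℤˣ, c.s ((A + c.omega ν) / 2 - (A - sgn q.2 * y q.1))) *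
      ∏ μ, c.s ((A + c.omega ν) / 2 - h μ))) /
  ((∏ q : Fin N × ℤˣ, c.s ((A + c.omega ν) / 2 - sgn q.2 * x q.1)) *
    ((∏ q : Fin M × ℤˣ, c.s ((A + c.omega ν) / 2 - sgn q.2 * y q.1)) *
      ((∏ μ, if μ = ν then 1 else c.s ((A + c.omega ν) / 2 - (A + c.omega μ) / 2)) *
        ∏ μ, c.s ((A + c.omega ν) / 2 - (B + c.omega μ) / 2))))

/-- No two poles of the source function coincide. -/
structure PolesDistinct (x : Fin N → ℂ) (y : Fin M → ℂ) : Prop where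
  x_x : ∀ p q : Fin N × ℤˣ, p ≠ q → c.s (sgn p.2 * x p.1 - sgn q.2 * x q.1) ≠ 0
  y_y : ∀ p q : Fin M × ℤˣ, p ≠ q → c.s (sgn p.2 * y p.1 - sgn q.2 * y q.1) ≠ 0
  x_y : ∀ (p : Fin N × ℤˣ) (q : Fin M × ℤˣ), c.s (sgn p.2 * x p.1 - sgn q.2 * y q.1) ≠ 0
  x_A : ∀ (p : Fin N × ℤˣ) (ν), c.s (sgn p.2 * x p.1 - (A + c.omega ν) / 2) ≠ 0
  x_B : ∀ (p : Fin N × ℤˣ) (ν), c.s (sgn p.2 * x p.1 - (B + c.omega ν) / 2) ≠ 0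
  y_A : ∀ (p : Fin M × ℤˣ) (ν), c.s (sgn p.2 * y p.1 - (A + c.omega ν) / 2) ≠ 0
  y_B : ∀ (p : Fin M × ℤˣ) (ν), c.s (sgn p.2 * y p.1 - (B + c.omega ν) / 2) ≠ 0
  A_B : ∀ ν μ, c.s ((A + c.omega ν) / 2 - (B + c.omega μ) / 2) ≠ 0

theorem sum_sgn_mul {N : ℕ} (x : Fin N → ℂ) : ∑ p : Fin N × ℤˣ, sgn p.2 * x p.1 = 0 := by
  rw [Fintype.sum_prod_type]
  refine Finset.sum_eq_zero fun j _ => ?_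
  simp [UnitsInt.univ, sgn]

/-- This is the residue theorem for the function whose poles are ±x_j, ±y_k and both families of
shifted half periods. It is invariant under exchanging (A, x) with (B, y), so the second and fourth
sums are the first and third with exchanged arguments. -/
theorem source_identity (hs : ∃ z, c.s z ≠ 0) (x : Fin N → ℂ) (y : Fin M → ℂ)
    (hd : c.PolesDistinct A B x y)
    (hb : c.IsElliptic → 2 * N * B + 2 * M * A + ∑ ν, h ν - (c.rho + 1) * (A + B) / 2 = 0) :
    ∑ p, c.residueAtPoint h A B x y p + ∑ p, c.residueAtPoint h B A y x p +
      ∑ ν, c.residueAtHalfPeriod h A B x y ν + ∑ ν, c.residueAtHalfPeriod h B A y x ν =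
    -c.s (2 * N * B + 2 * M * A + ∑ ν, h ν - (c.rho + 1) * (A + B) / 2 - ∑ ν, c.omega ν) := by
  -- Zeros and poles must be indexed by the same type: the 2ρ + 2 zeros h ν are paired with the two
  -- families of ρ + 1 half periods.
  let e : Fin (c.rho + 1) ⊕ Fin (c.rho + 1) ≃ Fin (2 * c.rho + 2) :=
    finSumFinEquiv.trans (finCongr (by omega))
  let a : (Fin N × ℤˣ) ⊕ (Fin M × ℤˣ) ⊕ (Fin (c.rho + 1) ⊕ Fin (c.rho + 1)) → ℂ :=
    Sum.elim (fun p => sgn p.2 * x p.1) (Sum.elim (fun p => sgn p.2 * y p.1)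
      (Sum.elim (fun ν => (A + c.omega ν) / 2) fun ν => (B + c.omega ν) / 2))
  let b : (Fin N × ℤˣ) ⊕ (Fin M × ℤˣ) ⊕ (Fin (c.rho + 1) ⊕ Fin (c.rho + 1)) → ℂ :=
    Sum.elim (fun p => B - sgn p.2 * x p.1) (Sum.elim (fun p => A - sgn p.2 * y p.1)
      fun i => h (e i))
  have hcard : (Fintype.card ℤˣ : ℂ) = 2 := by simp
  have hsum : ∑ i, a i - ∑ i, b i =
      -(2 * N * B + 2 * M * A + ∑ ν, h ν - (c.rho + 1) * (A + B) / 2 - ∑ ν, c.omega ν) := by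
    simp only [a, b, Fintype.sum_sum_type, Sum.elim_inl, Sum.elim_inr, Finset.sum_sub_distrib,
      sum_sgn_mul, ← Finset.sum_div, Finset.sum_add_distrib, Finset.sum_const, Finset.card_univ,
      nsmul_eq_mul, Fintype.card_prod, Fintype.card_fin, Nat.cast_mul, hcard, Nat.cast_add,
      Nat.cast_one]
    rw [← Fintype.sum_sum_type (fun i => h (e i)), Equiv.sum_comp e]
    ring
  have hodd : ∀ z w : ℂ, c.s (z - w) ≠ 0 → c.s (w - z) ≠ 0 := fun z w hzw => by
    rw [c.s_sub_comm]; exact neg_ne_zero.2 hzw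
  have key := c.sum_residue_univ hs a b ?_ ?_
  · rw [hsum, c.s_neg] at key
    rw [← key]
    simp only [a, b, Fintype.sum_sum_type, Sum.elim_inl, Sum.elim_inr, Fintype.prod_sum_type,
      Sum.inl.injEq, Sum.inr.injEq, reduceCtorEq, if_false]
    have hh : ∀ z, (∏ ν, c.s (z - h (e (Sum.inl ν)))) * ∏ ν, c.s (z - h (e (Sum.inr ν))) =
        ∏ ν, c.s (z - h ν) := fun z => by
      rw [← Fintype.prod_sum_type fun i => c.s (z - h (e i)),
        Equiv.prod_comp e fun ν => c.s (z - h ν)]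
    simp only [hh, add_assoc]
    congr 1
    congr 1
    · refine Finset.sum_congr rfl fun p _ => ?_
      unfold residueAtPoint
      congr 1 <;> ring
    congr 1
    refine Finset.sum_congr rfl fun p _ => ?_
    unfold residueAtHalfPeriod
    congr 1 <;> ring
  · rintro (p | p | ν | ν) (q | q | μ | μ) hpq <;> simp only [a, Sum.elim_inl, Sum.elim_inr]
    · exact hd.x_x p q fun h => hpq (by rw [h])
    · exact hd.x_y p q
    · exact hd.x_A p μ
    · exact hd.x_B p μ
    · exact hodd _ _ (hd.x_y q p)
    · exact hd.y_y p q fun h => hpq (by rw [h])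
    · exact hd.y_A p μ
    · exact hd.y_B p μ
    · exact hodd _ _ (hd.x_A q ν)
    · exact hodd _ _ (hd.y_A q ν)
    · have := c.s_half_period_sub_ne_zero hs (ν := ν) (μ := μ) fun h => hpq (by rw [h])
      convert this using 2
      ring
    · exact hd.A_B ν μ
    · exact hodd _ _ (hd.x_B q ν)
    · exact hodd _ _ (hd.y_B q ν)
    · exact hodd _ _ (hd.A_B μ ν)
    · have := c.s_half_period_sub_ne_zero hs (ν := ν) (μ := μ) fun h => hpq (by rw [h])
      convert this using 2
      ring
  · intro hE
    rw [← sub_eq_zero, hsum, hb hE, c.sum_omega_of_isElliptic hE]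
    simp

end

/-! ### Residues as coefficients of the operators -/

section

variable (c : ModelCase)

theorem prod_sign (F : ℤˣ → ℂ) : ∏ δ, F δ = F 1 * F (-1) := by
  rw [UnitsInt.univ, Finset.prod_pair (by decide)]

theorem prod_s_sign_ratio (ε : ℤˣ) (z w A : ℂ) :
    (∏ δ : ℤˣ, c.s (sgn ε * z - (A - sgn δ * w))) / ∏ δ : ℤˣ, c.s (sgn ε * z - sgn δ * w) =
      ∏ δ : ℤˣ, c.s (z + sgn δ * w - sgn ε * A) / c.s (z + sgn δ * w) := by
  simp only [prod_sign]
  rcases Int.units_eq_one_or ε with rfl | rfl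
  · simp only [sgn, Units.val_one, Int.cast_one, one_mul, Units.val_neg, Int.cast_neg, neg_mul]
    rw [show z - (A - w) = z + w - A by ring, show z - (A - -w) = z + -w - A by ring,
      show z - -w = z + w by ring, show z - w = z + -w by ring]
    ring
  · simp only [sgn, Units.val_one, Int.cast_one, one_mul, Units.val_neg, Int.cast_neg, neg_mul]
    rw [show -z - (A - w) = -(z + -w - -A) by ring, show -z - (A - -w) = -(z + w - -A) by ring,
      show -z - -w = -(z + -w) by ring, show -z - w = -(z + w) by ring, c.s_neg, c.s_neg, c.s_neg,
      c.s_neg]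
    ring

theorem prod_s_block_ratio {M : ℕ} (ε : ℤˣ) (z A : ℂ) (y : Fin M → ℂ) :
    (∏ q : Fin M × ℤˣ, c.s (sgn ε * z - (A - sgn q.2 * y q.1))) /
      ∏ q : Fin M × ℤˣ, c.s (sgn ε * z - sgn q.2 * y q.1) =
    ∏ δ : ℤˣ, ∏ k, c.s (z + sgn δ * y k - sgn ε * A) / c.s (z + sgn δ * y k) := by
  rw [Fintype.prod_prod_type, Fintype.prod_prod_type, ← Finset.prod_div_distrib, Finset.prod_comm]
  exact Finset.prod_congr rfl fun k _ => c.prod_s_sign_ratio ε z (y k) A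

/-- The two factors with index j are exceptional. The one with sign ε has numerator s(2εx_j - B) and
no denominator; the one with sign -ε gives -s(B)/s(2εx_j), the origin of the factor s(iλβ) in front
of the operator. -/
theorem prod_s_own_block_ratio {N : ℕ} (ε : ℤˣ) (j : Fin N) (B : ℂ) (x : Fin N → ℂ) :
    (∏ q : Fin N × ℤˣ, c.s (sgn ε * x j - (B - sgn q.2 * x q.1))) /
      (∏ q : Fin N × ℤˣ, if q = (j, ε) then 1 else c.s (sgn ε * x j - sgn q.2 * x q.1)) =
    c.s (sgn ε * (2 * x j) - B) * -c.s B / c.s (sgn ε * (2 * x j)) *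
      ∏ δ : ℤˣ, ∏ k ∈ Finset.univ.erase j,
        c.s (x j + sgn δ * x k - sgn ε * B) / c.s (x j + sgn δ * x k) := by
  rw [Fintype.prod_prod_type, Fintype.prod_prod_type, ← Finset.prod_div_distrib,
    Finset.prod_comm (s := Finset.univ), ← Finset.mul_prod_erase _ _ (Finset.mem_univ j)]
  congr 1
  · simp only [prod_sign]
    rcases Int.units_eq_one_or ε with rfl | rfl
    · rw [if_pos rfl, if_neg (by simp)]
      simp only [sgn, Units.val_one, Int.cast_one, one_mul, Units.val_neg, Int.cast_neg, neg_mul]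
      rw [show x j - (B - x j) = 2 * x j - B by ring, show x j - (B - -x j) = -B by ring,
        show x j - -x j = 2 * x j by ring, c.s_neg]
    · rw [if_neg (by simp), if_pos rfl]
      simp only [sgn, Units.val_one, Int.cast_one, one_mul, Units.val_neg, Int.cast_neg, neg_mul]
      rw [show -x j - (B - x j) = -B by ring, show -x j - (B - -x j) = -(2 * x j) - B by ring,
        show -x j - x j = -(2 * x j) by ring, c.s_neg B, mul_one, mul_comm]
  · refine Finset.prod_congr rfl fun k hk => ?_
    have hkj := Finset.ne_of_mem_erase hk
    rw [← c.prod_s_sign_ratio]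
    congr 1
    refine Finset.prod_congr rfl fun δ _ => if_neg ?_
    simp [hkj]

theorem prod_s_sub_half_periods (z A : ℂ) :
    ∏ ν, c.s (z - (A + c.omega ν) / 2) =
      c.s (2 * z - A) * (∏ ν : Fin c.rho, c.s (c.omega ν.succ / 2)) * (-1) ^ c.rho / 2 := by
  have h := c.s_two_mul (z - A / 2)
  have h1 : ((-1 : ℂ) ^ c.rho) * (-1) ^ c.rho = 1 := by rw [← mul_pow]; simp
  rw [show 2 * (z - A / 2) = 2 * z - A by ring] at h
  rw [h, mul_right_comm, mul_assoc 2, h1, mul_one, mul_div_cancel_left₀ _ two_ne_zero]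
  exact Finset.prod_congr rfl fun ν _ => by congr 1; ring

variable {N M : ℕ} (g : Fin (2 * c.rho + 2) → ℂ) (lam β : ℂ)

/-- By duplication, the half periods shifted by iβ/2 supply the denominator s(2εx_j - iβ) of V, and
those shifted by iλβ/2 supply s(2εx_j - iλβ), which cancels against the block of x. The remaining
constants cancel `prefactor`. -/
theorem residueAtPoint_eq (hs : ∃ z, c.s z ≠ 0) (x : Fin N → ℂ) (y : Fin M → ℂ) (j : Fin N)
    (ε : ℤˣ) (hne : c.s (sgn ε * (2 * x j) - I * lam * β) ≠ 0) :
    -c.prefactor * c.residueAtPoint (fun ν => I * g ν * β) (I * β) (I * lam * β) x y (j, ε) =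
      c.s (I * lam * β) * (coeffV c g lam β ε j x *
        ∏ δ : ℤˣ, ∏ k, c.s (x j + sgn δ * y k - sgn ε * (I * β)) / c.s (x j + sgn δ * y k)) := by
  have hP := c.prod_s_half_period_ne_zero hs
  rw [residueAtPoint, mul_div_mul_comm, mul_div_mul_comm, c.prod_s_block_ratio,
    c.prod_s_own_block_ratio, c.prod_s_sub_half_periods, c.prod_s_sub_half_periods, coeffV,
    prefactor, Finset.prod_pow]
  dsimp only
  rw [mul_left_comm 2 (sgn ε)]
  generalize ∏ ν : Fin c.rho, c.s (c.omega ν.succ / 2) = P at *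
  generalize (∏ δ : ℤˣ, ∏ k, c.s (x j + sgn δ * y k - sgn ε * (I * β)) / c.s (x j + sgn δ * y k)) =
    Y
  generalize (∏ δ : ℤˣ, ∏ k ∈ Finset.univ.erase j,
        c.s (x j + sgn δ * x k - sgn ε * (I * lam * β)) / c.s (x j + sgn δ * x k)) = X
  have h1 : ((-1 : ℂ) ^ c.rho) ^ 2 = 1 := by rw [← pow_mul, mul_comm, pow_mul]; simp
  have h2 : ((-1 : ℂ) ^ c.rho) ≠ 0 := by simp
  generalize c.s (sgn ε * (2 * x j) - I * lam * β) = K at *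
  field_simp
  simp only [h1]
  ring

/-- For each k, the arguments of the two numerator factors in y_k are the reflections at ω_ν/2 of
those of the denominator factors, so their ratio is an exponential independent of y_k. Hence the
potential depends on x alone. -/
theorem residueAtHalfPeriod_eq (x : Fin N → ℂ) (y : Fin M → ℂ) (ν : Fin (c.rho + 1))
    (hne : ∀ (q : Fin M × ℤˣ), c.s ((I * β + c.omega ν) / 2 - sgn q.2 * y q.1) ≠ 0) :
    c.residueAtHalfPeriod (fun ν => I * g ν * β) (I * β) (I * lam * β) x y ν =
      cexp (2 * c.rxi ν * M * β) / (∏ μ ∈ Finset.univ.erase ν, c.s ((c.omega ν - c.omega μ) / 2)) *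
        ((∏ μ, c.s (c.omega ν / 2 + I * β / 2 - I * g μ * β)) /
          ∏ μ, c.s ((c.omega ν - c.omega μ + I * (1 - lam) * β) / 2)) *
        ∏ δ : ℤˣ, ∏ j : Fin N, c.s (sgn δ * x j + c.omega ν / 2 + I * β / 2 - I * lam * β) /
          c.s (sgn δ * x j + c.omega ν / 2 + I * β / 2) := by
  have hx : (∏ q : Fin N × ℤˣ, c.s ((I * β + c.omega ν) / 2 - (I * lam * β - sgn q.2 * x q.1))) /
      (∏ q : Fin N × ℤˣ, c.s ((I * β + c.omega ν) / 2 - sgn q.2 * x q.1)) =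
      ∏ δ : ℤˣ, ∏ j : Fin N, c.s (sgn δ * x j + c.omega ν / 2 + I * β / 2 - I * lam * β) /
          c.s (sgn δ * x j + c.omega ν / 2 + I * β / 2) := by
    have := c.prod_s_block_ratio 1 ((I * β + c.omega ν) / 2) (I * lam * β) x
    simp only [sgn, Units.val_one, Int.cast_one, one_mul] at this
    simp only [sgn]
    rw [this]
    refine Finset.prod_congr rfl fun δ _ => Finset.prod_congr rfl fun j _ => ?_
    congr 2 <;> ring
  have hy : (∏ q : Fin M × ℤˣ, c.s ((I * β + c.omega ν) / 2 - (I * β - sgn q.2 * y q.1))) /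
      (∏ q : Fin M × ℤˣ, c.s ((I * β + c.omega ν) / 2 - sgn q.2 * y q.1)) =
      cexp (2 * c.rxi ν * M * β) := by
    rw [Fintype.prod_prod_type, Fintype.prod_prod_type, ← Finset.prod_div_distrib,
      show 2 * c.rxi ν * M * β = M * (2 * c.rxi ν * β) by ring, exp_nat_mul]
    rw [Finset.prod_congr rfl (g := fun _ => cexp (2 * c.rxi ν * β)), Finset.prod_const,
      Finset.card_univ, Fintype.card_fin]
    intro k _
    have h1 := hne (k, 1)
    have h2 := hne (k, -1)
    have h3 := c.s_half_period_add_mul ν (I * β / 2 - y k) (I * β / 2 + y k)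
    simp only [prod_sign]
    simp only [sgn, Units.val_one, Int.cast_one, one_mul, Units.val_neg, Int.cast_neg, neg_mul]
      at h1 h2 ⊢
    rw [div_eq_iff (mul_ne_zero h1 h2)]
    rw [show (I * β + c.omega ν) / 2 - (I * β - y k) = c.omega ν / 2 - (I * β / 2 - y k) by ring,
      show (I * β + c.omega ν) / 2 - (I * β - -y k) = c.omega ν / 2 - (I * β / 2 + y k) by ring,
      show (I * β + c.omega ν) / 2 - y k = c.omega ν / 2 + (I * β / 2 - y k) by ring,
      show (I * β + c.omega ν) / 2 - -y k = c.omega ν / 2 + (I * β / 2 + y k) by ring, h3,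
      ← mul_assoc, ← exp_add, show 2 * c.rxi ν * β + 2 * I * c.rxi ν *
      (I * β / 2 - y k + (I * β / 2 + y k)) = 0 by linear_combination 2 * c.rxi ν * β * I_sq,
      exp_zero, one_mul]
  have h1 : (∏ μ, if μ = ν then 1 else c.s ((I * β + c.omega ν) / 2 - (I * β + c.omega μ) / 2)) =
      ∏ μ ∈ Finset.univ.erase ν, c.s ((c.omega ν - c.omega μ) / 2) := by
    rw [← Finset.mul_prod_erase _ _ (Finset.mem_univ ν), if_pos rfl, one_mul]
    refine Finset.prod_congr rfl fun μ hμ => ?_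
    rw [if_neg (Finset.ne_of_mem_erase hμ)]
    congr 1
    ring
  have h2 : (∏ μ, c.s ((I * β + c.omega ν) / 2 - (I * lam * β + c.omega μ) / 2)) =
      ∏ μ, c.s ((c.omega ν - c.omega μ + I * (1 - lam) * β) / 2) :=
    Finset.prod_congr rfl fun μ _ => by congr 1; ring
  have h3 : (∏ μ, c.s ((I * β + c.omega ν) / 2 - I * g μ * β)) =
      ∏ μ, c.s (c.omega ν / 2 + I * β / 2 - I * g μ * β) :=
    Finset.prod_congr rfl fun μ _ => by congr 1; ring
  rw [residueAtHalfPeriod, mul_div_mul_comm, mul_div_mul_comm, hx, hy, h1, h2, h3]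
  ring

end

/-! ### The kernel identity at generic points -/

section

variable (c : ModelCase) {N M : ℕ}

/-- The points at which no denominator occurs in the operator with shift step `A`. -/
structure Admissible (A : ℂ) (x : Fin N → ℂ) : Prop where
  two_mul_ne : ∀ j, c.s (2 * x j) ≠ 0
  two_mul_sub_ne : ∀ (j) (ε : ℤˣ), c.s (sgn ε * (2 * x j) - A) ≠ 0
  pair_ne : ∀ j k, j ≠ k → ∀ δ : ℤˣ, c.s (x j + sgn δ * x k) ≠ 0

variable {c}

theorem s_sgn_mul (ε : ℤˣ) (z : ℂ) : c.s (sgn ε * z) = sgn ε * c.s z := by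
  rcases Int.units_eq_one_or ε with rfl | rfl <;> simp [sgn, c.s_neg]

theorem sgn_ne_zero (ε : ℤˣ) : sgn ε ≠ 0 := by
  rcases Int.units_eq_one_or ε with rfl | rfl <;> simp [sgn]

theorem s_sgn_mul_ne_zero {ε : ℤˣ} {z : ℂ} (h : c.s z ≠ 0) : c.s (sgn ε * z) ≠ 0 := by
  rw [s_sgn_mul]
  exact mul_ne_zero (sgn_ne_zero ε) h

theorem sgn_mul_sub_sgn_mul (ε δ : ℤˣ) (z w : ℂ) :
    sgn ε * z - sgn δ * w = sgn ε * (z + sgn (-(ε * δ)) * w) := by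
  rcases Int.units_eq_one_or ε with rfl | rfl <;> rcases Int.units_eq_one_or δ with rfl | rfl <;>
    simp [sgn] <;> ring

theorem Admissible.sub_half_period_ne_zero {A : ℂ} {x : Fin N → ℂ} (hx : c.Admissible A x)
    (hs : ∃ z, c.s z ≠ 0) (ε : ℤˣ) (j : Fin N) (ν : Fin (c.rho + 1)) :
    c.s (sgn ε * x j - (A + c.omega ν) / 2) ≠ 0 := by
  have h := c.s_sub_half_period_ne_zero (z := sgn ε * x j - A / 2) ?_ hs ν
  · convert h using 2; ring
  · convert hx.two_mul_sub_ne j ε using 2; ring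

theorem Admissible.sgn_sub_sgn_ne_zero {A : ℂ} {x : Fin N → ℂ} (hx : c.Admissible A x)
    (p q : Fin N × ℤˣ) (hpq : p ≠ q) : c.s (sgn p.2 * x p.1 - sgn q.2 * x q.1) ≠ 0 := by
  obtain ⟨j, ε⟩ := p
  obtain ⟨k, δ⟩ := q
  dsimp only
  by_cases hjk : j = k
  · subst hjk
    have hδ : δ = -ε := by
      rcases Int.units_eq_one_or ε with rfl | rfl <;> rcases Int.units_eq_one_or δ with rfl | rfl <;>
        simp_all
    subst hδ
    convert s_sgn_mul_ne_zero (ε := ε) (hx.two_mul_ne j) using 2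
    simp [sgn]
    ring
  · rw [sgn_mul_sub_sgn_mul]
    exact s_sgn_mul_ne_zero (hx.pair_ne j k hjk _)

theorem polesDistinct_of_admissible {A B : ℂ} {x : Fin N → ℂ} {y : Fin M → ℂ}
    (hs : ∃ z, c.s z ≠ 0) (hAB : c.s (A - B) ≠ 0)
    (hxA : c.Admissible A x) (hxB : c.Admissible B x) (hyA : c.Admissible A y)
    (hyB : c.Admissible B y) (hxy : ∀ j k (δ : ℤˣ), c.s (x j + sgn δ * y k) ≠ 0) :
    c.PolesDistinct A B x y where
  x_x := hxA.sgn_sub_sgn_ne_zero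
  y_y := hyA.sgn_sub_sgn_ne_zero
  x_y p q := by
    rw [sgn_mul_sub_sgn_mul]
    exact s_sgn_mul_ne_zero (hxy _ _ _)
  x_A p ν := hxA.sub_half_period_ne_zero hs _ _ _
  x_B p ν := hxB.sub_half_period_ne_zero hs _ _ _
  y_A p ν := hyA.sub_half_period_ne_zero hs _ _ _
  y_B p ν := hyB.sub_half_period_ne_zero hs _ _ _
  A_B ν μ := by
    have h := c.s_add_half_period_sub_ne_zero hs (z := (A - B) / 2) (ν := ν) (μ := μ)
      (by rwa [mul_div_cancel₀ _ two_ne_zero])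
    convert h using 2
    ring

variable (c) in
/-- The shift coefficient of the operator, multiplied by the change of `∏ s(x_j ± y_k)`. -/
noncomputable def shiftTerm (g : Fin (2 * c.rho + 2) → ℂ) (lam β : ℂ) (x : Fin N → ℂ)
    (y : Fin M → ℂ) (j : Fin N) (ε : ℤˣ) : ℂ :=
  coeffV c g lam β ε j x *
    ∏ δ : ℤˣ, ∏ k, c.s (x j + sgn δ * y k - sgn ε * (I * β)) / c.s (x j + sgn δ * y k)

variable (c) in
/-- The left hand side of the kernel identity, divided by the kernel function. -/
noncomputable def kernelQuotient (g : Fin (2 * c.rho + 2) → ℂ) (lam β : ℂ) (x : Fin N → ℂ)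
    (y : Fin M → ℂ) : ℂ :=
  c.s (I * lam * β) * ∑ ε : ℤˣ, ∑ j, c.shiftTerm g lam β x y j ε + coeffV0 c g lam β x

/-- One operator accounts for half of the source identity: the poles ±x_j and the half periods
shifted by iβ/2. -/
theorem kernelQuotient_eq_sum_residue (hs : ∃ z, c.s z ≠ 0) {g : Fin (2 * c.rho + 2) → ℂ}
    {lam β : ℂ} {x : Fin N → ℂ} {y : Fin M → ℂ} (hxB : c.Admissible (I * lam * β) x)
    (hyA : c.Admissible (I * β) y)
    (hb : c.IsElliptic → 2 * lam * N + 2 * M + ∑ ν, g ν - (c.rho + 1) * (lam + 1) / 2 = 0) :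
    c.kernelQuotient g lam β x y = -c.prefactor *
      (∑ p, c.residueAtPoint (fun ν => I * g ν * β) (I * β) (I * lam * β) x y p +
      ∑ ν, c.residueAtHalfPeriod (fun ν => I * g ν * β) (I * β) (I * lam * β) x y ν) := by
  have h1 : c.s (I * lam * β) * ∑ ε : ℤˣ, ∑ j, c.shiftTerm g lam β x y j ε = -c.prefactor *
      ∑ p, c.residueAtPoint (fun ν => I * g ν * β) (I * β) (I * lam * β) x y p := by
    rw [Fintype.sum_prod_type_right, Finset.mul_sum, Finset.mul_sum]
    refine Finset.sum_congr rfl fun ε _ => ?_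
    rw [Finset.mul_sum, Finset.mul_sum]
    refine Finset.sum_congr rfl fun j _ => ?_
    rw [c.residueAtPoint_eq g lam β hs x y j ε (hxB.two_mul_sub_ne j ε), shiftTerm]
  have h2 : coeffV0 c g lam β x = -c.prefactor *
      ∑ ν, c.residueAtHalfPeriod (fun ν => I * g ν * β) (I * β) (I * lam * β) x y ν := by
    rw [coeffV0]
    congr 1
    refine Finset.sum_congr rfl fun ν _ => ?_
    rw [c.residueAtHalfPeriod_eq]
    · congr 4
      -- The balancing relation identifies the exponent 2rξ_νMβ with the one in V^0; in the other
      -- cases both are zero.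
      linear_combination -β * c.rxi_mul_eq_zero hb ν
    · intro q
      rw [c.s_sub_comm]
      exact neg_ne_zero.2 (hyA.sub_half_period_ne_zero hs _ _ _)
  rw [kernelQuotient, h1, h2, mul_add]

/-- The parameters (g/λ, 1/λ, λβ) exchange iβ with iλβ and leave every ig_νβ fixed, so the operator
in y contributes the complementary residues. -/
theorem kernelQuotient_add_of_generic (hs : ∃ z, c.s z ≠ 0) {g : Fin (2 * c.rho + 2) → ℂ}
    {lam β : ℂ} (hlam : lam ≠ 0) (hAB : c.s (I * (1 - lam) * β) ≠ 0)
    {x : Fin N → ℂ} {y : Fin M → ℂ}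
    (hxA : c.Admissible (I * β) x) (hxB : c.Admissible (I * lam * β) x)
    (hyA : c.Admissible (I * β) y) (hyB : c.Admissible (I * lam * β) y)
    (hxy : ∀ j k (δ : ℤˣ), c.s (x j + sgn δ * y k) ≠ 0)
    (hb : c.IsElliptic → 2 * lam * N + 2 * M + ∑ ν, g ν - (c.rho + 1) * (lam + 1) / 2 = 0) :
    c.kernelQuotient g lam β x y +
      c.kernelQuotient (fun ν => g ν / lam) (1 / lam) (lam * β) y x =
      dualConstant c N M g lam β := by
  have e1 : I * (lam * β) = I * lam * β := by ring
  have e2 : I * (1 / lam) * (lam * β) = I * β := by field_simp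
  have e3 : (fun ν => I * (g ν / lam) * (lam * β)) = fun ν => I * g ν * β := by
    ext ν; field_simp
  have hb' : c.IsElliptic → 2 * (1 / lam) * M + 2 * N + ∑ ν, g ν / lam -
      (c.rho + 1) * (1 / lam + 1) / 2 = 0 := by
    intro hE
    rw [← Finset.sum_div]
    have := hb hE
    field_simp
    linear_combination 2 * this
  rw [kernelQuotient_eq_sum_residue hs hxB hyA hb,
    kernelQuotient_eq_sum_residue hs (by rwa [e2]) (by rwa [e1]) hb', e1, e2, e3, ← mul_add,
    dualConstant]
  have e4 : 2 * N * (I * lam * β) + 2 * M * (I * β) + ∑ ν, I * g ν * β -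
      (c.rho + 1) * (I * β + I * lam * β) / 2 =
      I * β * (2 * lam * N + 2 * M + ∑ ν, g ν - (c.rho + 1) * (lam + 1) / 2) := by
    rw [← Finset.sum_mul, ← Finset.mul_sum]
    ring
  have key := c.source_identity (fun ν => I * g ν * β) (I * β) (I * lam * β) hs x y
    (polesDistinct_of_admissible hs (by convert hAB using 2; ring) hxA hxB hyA hyB hxy)
    fun hE => by rw [e4, hb hE, mul_zero]
  rw [e4] at key
  linear_combination -c.prefactor * key

end

/-! ### Removal of genericity by a common translation of all variables -/

section

variable {c : ModelCase} {N M : ℕ}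

theorem Admissible.add_half_period_ne_zero {A : ℂ} {x : Fin N → ℂ} (hx : c.Admissible A x)
    (hs : ∃ z, c.s z ≠ 0) (δ : ℤˣ) (j : Fin N) (ν : Fin (c.rho + 1)) :
    c.s (sgn δ * x j + c.omega ν / 2 + A / 2) ≠ 0 := by
  rw [show sgn δ * x j + c.omega ν / 2 + A / 2 = -(sgn (-δ) * x j - (A + c.omega ν) / 2) by
    simp [sgn]; ring, c.s_neg]
  exact neg_ne_zero.2 (hx.sub_half_period_ne_zero hs _ _ _)

/-- The denominators s(2εx_j - iλβ) of the residues have cancelled, so admissibility for iβ alone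
suffices. -/
theorem continuousAt_kernelQuotient_add (hs : ∃ z, c.s z ≠ 0) (g : Fin (2 * c.rho + 2) → ℂ)
    (lam β : ℂ) {x : Fin N → ℂ} {y : Fin M → ℂ} (hx : c.Admissible (I * β) x)
    (hxy : ∀ j k (δ : ℤˣ), c.s (x j + sgn δ * y k) ≠ 0) :
    ContinuousAt (fun t : ℂ => c.kernelQuotient g lam β (fun j => x j + t) fun k => y k + t) 0 := by
  have hc := c.continuous_s
  have hquot : ∀ u v : ℂ → ℂ, Continuous u → Continuous v → c.s (v 0) ≠ 0 →
      ContinuousAt (fun t => c.s (u t) / c.s (v t)) 0 := fun u v hu hv h =>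
    (hc.comp hu).continuousAt.div (hc.comp hv).continuousAt h
  unfold kernelQuotient
  refine ContinuousAt.add (continuousAt_const.mul ?_) ?_
  · refine tendsto_finsetSum _ fun ε _ => tendsto_finsetSum _ fun j _ => ?_
    refine ContinuousAt.mul (ContinuousAt.mul (ContinuousAt.div ?_ ?_ ?_) ?_) ?_
    · exact Continuous.continuousAt (by fun_prop)
    · exact Continuous.continuousAt (by fun_prop)
    · simp only [add_zero]
      exact mul_ne_zero (s_sgn_mul_ne_zero (hx.two_mul_ne j)) (hx.two_mul_sub_ne j ε)
    · refine tendsto_finsetProd _ fun δ _ => tendsto_finsetProd _ fun k hk => ?_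
      refine hquot _ _ (by fun_prop) (by fun_prop) ?_
      simpa using hx.pair_ne j k (Finset.ne_of_mem_erase hk).symm δ
    · refine tendsto_finsetProd _ fun δ _ => tendsto_finsetProd _ fun k hk => ?_
      refine hquot _ _ (by fun_prop) (by fun_prop) ?_
      simpa using hxy j k δ
  · refine continuousAt_const.mul (tendsto_finsetSum _ fun ν _ => continuousAt_const.mul ?_)
    refine tendsto_finsetProd _ fun δ _ => tendsto_finsetProd _ fun j _ => ?_
    refine hquot _ _ (by fun_prop) (by fun_prop) ?_
    simpa using hx.add_half_period_ne_zero hs δ j ν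

theorem Admissible.eventually_add {A : ℂ} {x : Fin N → ℂ} (hx : c.Admissible A x) :
    ∀ᶠ t in nhds (0 : ℂ), c.Admissible A fun j => x j + t := by
  have hc := c.continuous_s
  have hev : ∀ u : ℂ → ℂ, Continuous u → c.s (u 0) ≠ 0 → ∀ᶠ t in nhds (0 : ℂ), c.s (u t) ≠ 0 :=
    fun u hu h => (hc.comp hu).continuousAt.eventually_ne h
  have h1 : ∀ᶠ t in nhds (0 : ℂ), ∀ j, c.s (2 * (x j + t)) ≠ 0 :=
    Filter.eventually_all.2 fun j => hev _ (by fun_prop) (by simpa using hx.two_mul_ne j)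
  have h2 : ∀ᶠ t in nhds (0 : ℂ), ∀ (j) (ε : ℤˣ), c.s (sgn ε * (2 * (x j + t)) - A) ≠ 0 :=
    Filter.eventually_all.2 fun j => Filter.eventually_all.2 fun ε =>
      hev _ (by fun_prop) (by simpa using hx.two_mul_sub_ne j ε)
  have h3 : ∀ᶠ t in nhds (0 : ℂ), ∀ j k, j ≠ k → ∀ δ : ℤˣ,
      c.s (x j + t + sgn δ * (x k + t)) ≠ 0 :=
    Filter.eventually_all.2 fun j => Filter.eventually_all.2 fun k =>
      Filter.eventually_imp_distrib_left.2 fun hjk => Filter.eventually_all.2 fun δ =>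
        hev _ (by fun_prop) (by simpa using hx.pair_ne j k hjk δ)
  filter_upwards [h1, h2, h3] with t h1 h2 h3
  exact ⟨h1, h2, h3⟩

/-- The additional condition for B involves s at arguments that are nonconstant affine functions of
t, hence fails only at isolated t; the remaining conditions are open. -/
theorem Admissible.eventually_add_of_ne (hs : ∃ z, c.s z ≠ 0) {A : ℂ} {x : Fin N → ℂ}
    (hx : c.Admissible A x) (B : ℂ) :
    ∀ᶠ t in nhdsWithin (0 : ℂ) {0}ᶜ, c.Admissible B fun j => x j + t := by
  have h : ∀ᶠ t in nhdsWithin (0 : ℂ) {0}ᶜ, ∀ (j) (ε : ℤˣ),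
      c.s (sgn ε * (2 * (x j + t)) - B) ≠ 0 :=
    Filter.eventually_all.2 fun j => Filter.eventually_all.2 fun ε => by
      filter_upwards [c.eventually_s_ne_zero hs (mul_ne_zero (sgn_ne_zero ε) two_ne_zero)
        (sgn ε * (2 * x j) - B)] with t ht
      convert ht using 2
      ring
  filter_upwards [h, nhdsWithin_le_nhds hx.eventually_add] with t h1 h2
  exact ⟨h2.two_mul_ne, h1, h2.pair_ne⟩

/-- The conditions on x relative to iλβ and on y relative to iβ stem only from the poles of the
auxiliary function, not from the operators. They hold after a small nonzero translation, and both
sides are continuous in it. -/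
theorem kernelQuotient_add (hs : ∃ z, c.s z ≠ 0) {g : Fin (2 * c.rho + 2) → ℂ}
    {lam β : ℂ} (hlam : lam ≠ 0) (hAB : c.s (I * (1 - lam) * β) ≠ 0)
    {x : Fin N → ℂ} {y : Fin M → ℂ}
    (hx : c.Admissible (I * β) x) (hy : c.Admissible (I * (lam * β)) y)
    (hxy : ∀ j k (δ : ℤˣ), c.s (x j + sgn δ * y k) ≠ 0)
    (hb : c.IsElliptic → 2 * lam * N + 2 * M + ∑ ν, g ν - (c.rho + 1) * (lam + 1) / 2 = 0) :
    c.kernelQuotient g lam β x y +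
      c.kernelQuotient (fun ν => g ν / lam) (1 / lam) (lam * β) y x =
      dualConstant c N M g lam β := by
  have hyx : ∀ k j (δ : ℤˣ), c.s (y k + sgn δ * x j) ≠ 0 := by
    intro k j δ
    have := s_sgn_mul_ne_zero (ε := δ) (hxy j k δ)
    convert this using 2
    rcases Int.units_eq_one_or δ with rfl | rfl
    · simp [sgn, add_comm]
    · simp [sgn]
  have hcont := (continuousAt_kernelQuotient_add hs g lam β hx hxy).add
    (continuousAt_kernelQuotient_add hs (fun ν => g ν / lam) (1 / lam) (lam * β) hy hyx)
  have hxyt : ∀ᶠ t in nhds (0 : ℂ), ∀ j k (δ : ℤˣ), c.s (x j + t + sgn δ * (y k + t)) ≠ 0 :=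
    Filter.eventually_all.2 fun j => Filter.eventually_all.2 fun k => Filter.eventually_all.2
      fun δ => (c.continuous_s.comp (g := c.s) (f := fun t : ℂ => x j + t + sgn δ * (y k + t))
        (by fun_prop)).continuousAt.eventually_ne (by simpa using hxy j k δ)
  have hev : ∀ᶠ t in nhdsWithin (0 : ℂ) {0}ᶜ,
      c.kernelQuotient g lam β (fun j => x j + t) (fun k => y k + t) +
      c.kernelQuotient (fun ν => g ν / lam) (1 / lam) (lam * β) (fun k => y k + t)
        (fun j => x j + t) = dualConstant c N M g lam β := by
    filter_upwards [hx.eventually_add_of_ne hs (I * β), hx.eventually_add_of_ne hs (I * lam * β),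
      hy.eventually_add_of_ne hs (I * β), hy.eventually_add_of_ne hs (I * lam * β),
      nhdsWithin_le_nhds hxyt] with t h1 h2 h3 h4 h5
    exact kernelQuotient_add_of_generic hs hlam hAB h1 h2 h3 h4 h5 hb
  have := tendsto_nhds_unique_of_eventuallyEq (hcont.tendsto.mono_left nhdsWithin_le_nhds)
    (tendsto_const_nhds (x := dualConstant c N M g lam β)) hev
  simpa using this

end

end ModelCase
-- Behaviour of the Gamma products under a shift of one variable
-- The denominators will be values of γ, which may be zero. The relation forces D and D' to vanish
-- together, and then both quotients are 0 by convention.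
theorem div_eq_div_of_mul_eq {a b D D' : ℂ} (ha : a ≠ 0) (hb : b ≠ 0) (h : a * D' = b * D) :
    b / D' = a / D := by
  by_cases hD : D = 0
  · have hD' : D' = 0 := by simpa [hD, ha] using h
    simp [hD, hD']
  · have hD' : D' ≠ 0 := by
      rintro rfl
      rw [mul_zero] at h
      exact mul_ne_zero hb hD h.symm
    rw [div_eq_div_iff hD' hD, h]

/-- A product over pairs, with the factors that contain a given index split off. -/
theorem prod_Ioi_eq_mul {N : ℕ} (Q : ℂ → ℂ → ℂ) (hQ : ∀ u v, Q u v = Q v u) (x : Fin N → ℂ)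
    (j : Fin N) : ∏ i, ∏ k ∈ Finset.Ioi i, Q (x i) (x k) =
      (∏ k ∈ Finset.univ.erase j, Q (x j) (x k)) *
        ∏ i ∈ Finset.univ.erase j, ∏ k ∈ Finset.univ.erase j,
          if i < k then Q (x i) (x k) else 1 := by
  have h1 : ∀ i : Fin N, ∏ k ∈ Finset.Ioi i, Q (x i) (x k) =
      ∏ k, if i < k then Q (x i) (x k) else 1 := fun i => by
    rw [← Finset.prod_filter]
    congr 1
    ext k
    simp
  simp only [h1]
  rw [← Finset.mul_prod_erase _ _ (Finset.mem_univ j)]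
  have h2 : ∀ i, ∏ k, (if i < k then Q (x i) (x k) else 1) = (if i < j then Q (x i) (x j) else 1) *
      ∏ k ∈ Finset.univ.erase j, if i < k then Q (x i) (x k) else 1 := fun i => by
    rw [← Finset.mul_prod_erase _ _ (Finset.mem_univ j)]
  simp only [h2]
  rw [Finset.prod_mul_distrib, ← mul_assoc, if_neg (lt_irrefl j), one_mul,
    ← Finset.prod_mul_distrib]
  congr 1
  refine Finset.prod_congr rfl fun k hk => ?_
  rcases lt_or_gt_of_ne (Finset.ne_of_mem_erase hk) with h | h
  · rw [if_pos h, if_neg h.le.not_gt, one_mul, hQ]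
  · rw [if_pos h, if_neg h.le.not_gt, mul_one]

section Shift

variable {β lam κ : ℂ} {γ R : ℂ → ℂ}

/-- The coefficient for the opposite shift, taken at u - iβ, is the original one taken at iβ - u.
Each Gamma factor changes by κ times a root of s, and these roots are those of the two coefficients;
the powers of κ cancel. -/
theorem single_factor_shift {n : ℕ} (g : Fin n → ℂ)
    (hγ : ∀ z, R z ≠ 0 → γ (z + I * β / 2) = κ * R z * γ (z - I * β / 2)) {u : ℂ} (hκ : κ ≠ 0)
    (h1 : ∀ ν, R (u - I * g ν * β) ≠ 0) (h2 : R (2 * u) ≠ 0) (h3 : R (2 * u - I * β) ≠ 0)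
    (h4 : ∀ ν, R (I * β - u - I * g ν * β) ≠ 0) (h5 : R (2 * (I * β - u)) ≠ 0)
    (h6 : R (2 * (I * β - u) - I * β) ≠ 0) :
    (∏ ν, R (I * β - u - I * g ν * β)) / (R (2 * (I * β - u)) * R (2 * (I * β - u) - I * β)) *
      (γ (2 * (u - I * β) + I * β / 2) * γ (-2 * (u - I * β) + I * β / 2) /
        ∏ ν, γ (u - I * β + I * β / 2 - I * g ν * β) *
          γ (-(u - I * β) + I * β / 2 - I * g ν * β)) =
    (∏ ν, R (u - I * g ν * β)) / (R (2 * u) * R (2 * u - I * β)) *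
      (γ (2 * u + I * β / 2) * γ (-2 * u + I * β / 2) /
        ∏ ν, γ (u + I * β / 2 - I * g ν * β) * γ (-u + I * β / 2 - I * g ν * β)) := by
  have hν : ∀ ν, R (I * β - u - I * g ν * β) / (γ (u - I * β + I * β / 2 - I * g ν * β) *
      γ (-(u - I * β) + I * β / 2 - I * g ν * β)) = R (u - I * g ν * β) /
      (γ (u + I * β / 2 - I * g ν * β) * γ (-u + I * β / 2 - I * g ν * β)) := fun ν => by
    refine div_eq_div_of_mul_eq (h1 ν) (h4 ν) ?_
    have e1 := hγ _ (h1 ν)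
    have e2 := hγ _ (h4 ν)
    rw [show u + I * β / 2 - I * g ν * β = u - I * g ν * β + I * β / 2 by ring, e1,
      show -(u - I * β) + I * β / 2 - I * g ν * β = I * β - u - I * g ν * β + I * β / 2 by ring, e2,
      show u - I * β + I * β / 2 - I * g ν * β = u - I * g ν * β - I * β / 2 by ring,
      show I * β - u - I * g ν * β - I * β / 2 = -u + I * β / 2 - I * g ν * β by ring]
    ring
  have hprod := Finset.prod_congr (rfl : (Finset.univ : Finset (Fin n)) = _) fun ν _ => hν ν
  rw [Finset.prod_div_distrib, Finset.prod_div_distrib] at hprod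
  have hnum : γ (2 * (u - I * β) + I * β / 2) * γ (-2 * (u - I * β) + I * β / 2) /
      (R (2 * (I * β - u)) * R (2 * (I * β - u) - I * β)) =
      γ (2 * u + I * β / 2) * γ (-2 * u + I * β / 2) / (R (2 * u) * R (2 * u - I * β)) := by
    -- The arguments ±2u move by 2iβ, so the functional equation is needed twice for each sign.
    have e2 := hγ _ h2
    have e3 := hγ _ h3
    have e5 := hγ _ h5
    have e6 := hγ _ h6
    rw [show 2 * u - I * β + I * β / 2 = 2 * u - I * β / 2 by ring,
      show 2 * u - I * β - I * β / 2 = 2 * (u - I * β) + I * β / 2 by ring] at e3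
    rw [show 2 * (I * β - u) - I * β + I * β / 2 = 2 * (I * β - u) - I * β / 2 by ring,
      show 2 * (I * β - u) - I * β - I * β / 2 = -2 * u + I * β / 2 by ring] at e6
    rw [show 2 * (I * β - u) + I * β / 2 = -2 * (u - I * β) + I * β / 2 by ring, e6] at e5
    rw [e3] at e2
    rw [e2, e5]
    field_simp
  have hc : ∀ a b c d : ℂ, a / b * (c / d) = a / d * (c / b) := by intros; ring
  rw [hc, hprod, hnum, hc]

/-- Both sides reduce to γ(w - iβ/2)γ(-w + iβ/2) divided by the same product with iλβ subtracted
from each argument. -/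
theorem pair_factor_shift
    (hγ : ∀ z, R z ≠ 0 → γ (z + I * β / 2) = κ * R z * γ (z - I * β / 2)) {w : ℂ} (hκ : κ ≠ 0)
    (h1 : R w ≠ 0) (h2 : R (w - I * lam * β) ≠ 0) (h3 : R (I * β - w) ≠ 0)
    (h4 : R (I * β - w - I * lam * β) ≠ 0) :
    R (I * β - w - I * lam * β) / R (I * β - w) *
      (γ (w - I * β + I * β / 2) / γ (w - I * β - I * lam * β + I * β / 2) *
        (γ (I * β - w + I * β / 2) / γ (I * β - w - I * lam * β + I * β / 2))) =
    R (w - I * lam * β) / R w * (γ (w + I * β / 2) / γ (w - I * lam * β + I * β / 2) *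
        (γ (-w + I * β / 2) / γ (-w - I * lam * β + I * β / 2))) := by
  rw [hγ _ h1, hγ _ h2, hγ _ h3, hγ _ h4, show w - I * β + I * β / 2 = w - I * β / 2 by ring,
    show w - I * β - I * lam * β + I * β / 2 = w - I * lam * β - I * β / 2 by ring,
    show I * β - w - I * β / 2 = -w + I * β / 2 by ring,
    show I * β - w - I * lam * β - I * β / 2 = -w - I * lam * β + I * β / 2 by ring]
  generalize R (w - I * lam * β) = r₂ at *
  generalize R (I * β - w - I * lam * β) = r₄ at *
  generalize γ (w - I * β / 2) = a
  generalize γ (w - I * lam * β - I * β / 2) = b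
  generalize γ (-w + I * β / 2) = d
  generalize γ (-w - I * lam * β + I * β / 2) = e
  field_simp

end Shift

/-- The factor of `gammaProduct` that belongs to one variable. -/
noncomputable def singleGamma {n : ℕ} (γ : ℂ → ℂ) (g : Fin n → ℂ) (β u : ℂ) : ℂ :=
  γ (2 * u + I * β / 2) * γ (-2 * u + I * β / 2) /
    ∏ ν, γ (u + I * β / 2 - I * g ν * β) * γ (-u + I * β / 2 - I * g ν * β)

/-- The factor of `gammaProduct` that belongs to a pair of variables. -/
noncomputable def pairGamma (γ : ℂ → ℂ) (lam β u v : ℂ) : ℂ :=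
  ∏ ε : ℤˣ, ∏ ε' : ℤˣ, γ (sgn ε * u + sgn ε' * v + I * β / 2) /
    γ (sgn ε * u + sgn ε' * v - I * lam * β + I * β / 2)

/-- Evenness, here and in `pairGamma_sgn_mul`, permits treating both shift directions at once in the
variable u = εx_j. -/
theorem singleGamma_sgn_mul {n : ℕ} (γ : ℂ → ℂ) (g : Fin n → ℂ) (β u : ℂ) (ε : ℤˣ) :
    singleGamma γ g β (sgn ε * u) = singleGamma γ g β u := by
  rcases Int.units_eq_one_or ε with rfl | rfl
  · simp [sgn]
  · have h : sgn (-1) * u = -u := by simp [sgn]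
    rw [h, singleGamma, singleGamma, mul_neg, neg_mul_neg, ← neg_mul, neg_neg, mul_comm (γ _)]
    congr 1
    exact Finset.prod_congr rfl fun ν _ => mul_comm _ _

theorem pairGamma_comm (γ : ℂ → ℂ) (lam β u v : ℂ) :
    pairGamma γ lam β u v = pairGamma γ lam β v u := by
  rw [pairGamma, pairGamma, Finset.prod_comm]
  simp only [add_comm (sgn _ * u)]

theorem pairGamma_sgn_mul (γ : ℂ → ℂ) (lam β u v : ℂ) (ε : ℤˣ) :
    pairGamma γ lam β (sgn ε * u) v = pairGamma γ lam β u v := by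
  rw [pairGamma, pairGamma, ← Equiv.prod_comp (Equiv.mulRight ε)]
  refine Finset.prod_congr rfl fun δ _ => Finset.prod_congr rfl fun δ' _ => ?_
  have h : sgn (Equiv.mulRight ε δ) * (sgn ε * u) = sgn δ * u := by
    rcases Int.units_eq_one_or ε with rfl | rfl <;> simp [sgn]
  rw [h]

theorem pairGamma_eq (γ : ℂ → ℂ) (lam β u v : ℂ) :
    pairGamma γ lam β u v = ∏ δ : ℤˣ, (γ (u + sgn δ * v + I * β / 2) /
      γ (u + sgn δ * v - I * lam * β + I * β / 2) * (γ (-(u + sgn δ * v) + I * β / 2) /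
      γ (-(u + sgn δ * v) - I * lam * β + I * β / 2))) := by
  simp only [pairGamma, ModelCase.prod_sign, sgn, Units.val_one, Int.cast_one, one_mul,
    Units.val_neg, Int.cast_neg, neg_mul, neg_add, neg_neg]
  ring

theorem gammaProduct_eq (c : ModelCase) {N : ℕ} (g : Fin (2 * c.rho + 2) → ℂ) (lam β : ℂ)
    (γ : ℂ → ℂ) (x : Fin N → ℂ) (j : Fin N) :
    gammaProduct c g lam β γ x = (singleGamma γ g β (x j) *
      ∏ k ∈ Finset.univ.erase j, pairGamma γ lam β (x j) (x k)) *
      ((∏ k ∈ Finset.univ.erase j, singleGamma γ g β (x k)) *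
        ∏ i ∈ Finset.univ.erase j, ∏ k ∈ Finset.univ.erase j,
          if i < k then pairGamma γ lam β (x i) (x k) else 1) := by
  have h1 := prod_Ioi_eq_mul (pairGamma γ lam β) (pairGamma_comm γ lam β) x j
  have h2 := Finset.mul_prod_erase Finset.univ (fun k => singleGamma γ g β (x k))
    (Finset.mem_univ j)
  rw [mul_mul_mul_comm, h2, ← h1]
  rfl

theorem gammaProduct_update (c : ModelCase) {N : ℕ} (g : Fin (2 * c.rho + 2) → ℂ) (lam β : ℂ)
    (γ : ℂ → ℂ) (x : Fin N → ℂ) (j : Fin N) (v : ℂ) :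
    gammaProduct c g lam β γ (Function.update x j v) = (singleGamma γ g β v *
      ∏ k ∈ Finset.univ.erase j, pairGamma γ lam β v (x k)) *
      ((∏ k ∈ Finset.univ.erase j, singleGamma γ g β (x k)) *
        ∏ i ∈ Finset.univ.erase j, ∏ k ∈ Finset.univ.erase j,
          if i < k then pairGamma γ lam β (x i) (x k) else 1) := by
  have hk : ∀ k ∈ Finset.univ.erase j, Function.update x j v k = x k := fun k hk => by
    rw [Function.update_of_ne (Finset.ne_of_mem_erase hk)]
  rw [gammaProduct_eq c g lam β γ _ j, Function.update_self]
  congr 1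
  · congr 1
    exact Finset.prod_congr rfl fun k hk' => by rw [hk k hk']
  · congr 1
    · exact Finset.prod_congr rfl fun k hk' => by rw [hk k hk']
    · exact Finset.prod_congr rfl fun i hi =>
        Finset.prod_congr rfl fun k hk' => by rw [hk k hk', hk i hi]

/-- This is the gauge property of Ψ. Multiplied by the root of V_j^ε that stands in front of the
shift, it gives V_j^ε itself, and no square root survives. -/
theorem rootV_neg_mul_gammaProduct_shift {c : ModelCase} {N : ℕ} {g : Fin (2 * c.rho + 2) → ℂ}
    {lam β κ : ℂ} {γ R : ℂ → ℂ} (hκ : κ ≠ 0)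
    (hγ : ∀ z, R z ≠ 0 → γ (z + I * β / 2) = κ * R z * γ (z - I * β / 2))
    {ε : ℤˣ} {j : Fin N} {x : Fin N → ℂ} (h1 : rootV c g lam β R ε j x ≠ 0)
    (h2 : rootV c g lam β R (-ε) j (shift β ε j x) ≠ 0) :
    rootV c g lam β R (-ε) j (shift β ε j x) * gammaProduct c g lam β γ (shift β ε j x) =
      rootV c g lam β R ε j x * gammaProduct c g lam β γ x := by
  have hsq : sgn ε * sgn ε = 1 := by
    rcases Int.units_eq_one_or ε with rfl | rfl <;> simp [sgn]
  have hneg : sgn (-ε) = -sgn ε := by simp [sgn]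
  have hj : shift β ε j x j = sgn ε * (sgn ε * x j - I * β) := by
    rw [shift, Function.update_self]
    linear_combination (-x j) * hsq
  have hk : ∀ k ∈ Finset.univ.erase j, shift β ε j x k = x k := fun k hk => by
    rw [shift, Function.update_of_ne (Finset.ne_of_mem_erase hk)]
  have hW : rootV c g lam β R ε j x = (∏ ν, R (sgn ε * x j - I * g ν * β)) /
      (R (2 * (sgn ε * x j)) * R (2 * (sgn ε * x j) - I * β)) *
      ∏ k ∈ Finset.univ.erase j, ∏ δ : ℤˣ,
        R (sgn ε * x j + sgn δ * x k - I * lam * β) / R (sgn ε * x j + sgn δ * x k) := by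
    rw [rootV, Finset.prod_comm, mul_left_comm (sgn ε)]
  have hW' : rootV c g lam β R (-ε) j (shift β ε j x) =
      (∏ ν, R (I * β - sgn ε * x j - I * g ν * β)) /
      (R (2 * (I * β - sgn ε * x j)) * R (2 * (I * β - sgn ε * x j) - I * β)) *
      ∏ k ∈ Finset.univ.erase j, ∏ δ : ℤˣ,
        R (I * β - (sgn ε * x j + sgn δ * x k) - I * lam * β) /
          R (I * β - (sgn ε * x j + sgn δ * x k)) := by
    have h3 : sgn (-ε) * shift β ε j x j = I * β - sgn ε * x j := by
      rw [hj, hneg]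
      linear_combination (-(sgn ε * x j - I * β)) * hsq
    rw [rootV, Finset.prod_comm, mul_left_comm (sgn (-ε)), h3]
    congr 1
    refine Finset.prod_congr rfl fun k hk' => ?_
    -- In the root for -ε the sign of x_j is reversed; reversing δ as well exhibits each argument as
    -- iβ minus the original one.
    rw [hk k hk', ← Equiv.prod_comp (Equiv.neg ℤˣ)]
    refine Finset.prod_congr rfl fun δ _ => ?_
    have h4 : sgn (Equiv.neg ℤˣ δ) = -sgn δ := by simp [sgn]
    rw [h4]
    congr 2 <;> ring
  rw [hW] at h1
  rw [hW'] at h2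
  have hv : shift β ε j x = Function.update x j (sgn ε * (sgn ε * x j - I * β)) := by
    rw [← hj, shift, Function.update_self]
  rw [hW, hW', hv, gammaProduct_update, gammaProduct_eq c g lam β γ x j,
    singleGamma_sgn_mul, ← singleGamma_sgn_mul γ g β (x j) ε]
  have hmul : ∀ a a' p p' r : ℂ, a * p = a' * p' → a * (p * r) = a' * (p' * r) := by
    intro a a' p p' r h
    rw [← mul_assoc, h, mul_assoc]
  refine hmul _ _ _ _ _ ?_
  have hpg : ∀ v, pairGamma γ lam β (x j) v = pairGamma γ lam β (sgn ε * x j) v := fun v =>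
    (pairGamma_sgn_mul _ _ _ _ _ _).symm
  simp only [hpg, pairGamma_sgn_mul γ lam β (sgn ε * x j - I * β)]
  clear hW hW' hv hj hpg
  generalize sgn ε * x j = u at *
  simp only [mul_ne_zero_iff, div_ne_zero_iff, Finset.prod_ne_zero_iff, Finset.mem_univ,
    forall_true_left] at h1 h2
  obtain ⟨⟨a1, a2, a3⟩, a4⟩ := h1
  obtain ⟨⟨b1, b2, b3⟩, b4⟩ := h2
  have hmul' : ∀ a d p q a' d' p' q' : ℂ, a * p = a' * p' → d * q = d' * q' →
      a * d * (p * q) = a' * d' * (p' * q') := by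
    intro a d p q a' d' p' q' h h'
    rw [mul_mul_mul_comm, h, h', mul_mul_mul_comm]
  refine hmul' _ _ _ _ _ _ _ _ ?_ ?_
  · exact single_factor_shift g hγ hκ a1 a2 a3 b1 b2 b3
  · rw [← Finset.prod_mul_distrib, ← Finset.prod_mul_distrib]
    refine Finset.prod_congr rfl fun k hk' => ?_
    rw [pairGamma_eq, pairGamma_eq, ← Finset.prod_mul_distrib, ← Finset.prod_mul_distrib]
    refine Finset.prod_congr rfl fun δ _ => ?_
    have := pair_factor_shift (lam := lam) hγ hκ (a4 k hk' δ).2 (a4 k hk' δ).1 (b4 k hk' δ).2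
      (b4 k hk' δ).1
    convert this using 6 <;> ring

/-! ### Action of the operators on the kernel function -/

/-- The product of the values `s(x_j ± y_k)`. -/
noncomputable def kernelProduct (c : ModelCase) {N M : ℕ} (x : Fin N → ℂ) (y : Fin M → ℂ) : ℂ :=
  ∏ j, ∏ δ : ℤˣ, ∏ k, c.s (x j + sgn δ * y k)

/-- Each pair (j, k) contributes one sign, since s is odd. The total sign is constant, hence
harmless when the operator acts on y. -/
theorem kernelProduct_comm (c : ModelCase) {N M : ℕ} (x : Fin N → ℂ) (y : Fin M → ℂ) :
    kernelProduct c x y = (-1) ^ (N * M) * kernelProduct c y x := by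
  have h : ∀ j k, ∏ δ : ℤˣ, c.s (x j + sgn δ * y k) =
      -1 * ∏ δ : ℤˣ, c.s (y k + sgn δ * x j) := fun j k => by
    simp only [ModelCase.prod_sign, sgn, Units.val_one, Int.cast_one, one_mul, Units.val_neg,
      Int.cast_neg, neg_mul, ← sub_eq_add_neg]
    rw [c.s_sub_comm (x j), add_comm]
    ring
  have h1 : ∀ {N M : ℕ} (x : Fin N → ℂ) (y : Fin M → ℂ), kernelProduct c x y =
      ∏ j, ∏ k, ∏ δ : ℤˣ, c.s (x j + sgn δ * y k) := fun x y =>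
    Finset.prod_congr rfl fun j _ => Finset.prod_comm
  rw [h1, h1, Finset.prod_comm (s := (Finset.univ : Finset (Fin M)))]
  simp only [h, Finset.prod_mul_distrib, Finset.prod_const, Finset.card_univ, Fintype.card_fin,
    ← pow_mul]
  rw [mul_comm M N]

theorem kernelProduct_shift (c : ModelCase) {N M : ℕ} (x : Fin N → ℂ) (y : Fin M → ℂ) (β : ℂ)
    (ε : ℤˣ) (j : Fin N) (hxy : ∀ j k (δ : ℤˣ), c.s (x j + sgn δ * y k) ≠ 0) :
    kernelProduct c (shift β ε j x) y = (∏ δ : ℤˣ, ∏ k,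
      c.s (x j + sgn δ * y k - sgn ε * (I * β)) / c.s (x j + sgn δ * y k)) *
      kernelProduct c x y := by
  rw [kernelProduct, kernelProduct, ← Finset.mul_prod_erase _ _ (Finset.mem_univ j),
    ← Finset.mul_prod_erase _ _ (Finset.mem_univ j), ← mul_assoc, ← Finset.prod_mul_distrib]
  congr 1
  · refine Finset.prod_congr rfl fun δ _ => ?_
    rw [← Finset.prod_mul_distrib]
    refine Finset.prod_congr rfl fun k _ => ?_
    rw [div_mul_cancel₀ _ (hxy j k δ), shift, Function.update_self]
    congr 1
    ring
  · refine Finset.prod_congr rfl fun i hi => ?_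
    rw [shift, Function.update_of_ne (Finset.ne_of_mem_erase hi)]

theorem admissible_of_isRegularPoint {c : ModelCase} {N : ℕ} {g : Fin (2 * c.rho + 2) → ℂ}
    {lam β : ℂ} {x : Fin N → ℂ} (hx : IsRegularPoint c g lam β x) : c.Admissible (I * β) x := by
  have h : ∀ ε j, coeffV c g lam β ε j x ≠ 0 := fun ε j => (hx ε j).1
  simp only [coeffV, mul_ne_zero_iff, div_ne_zero_iff, Finset.prod_ne_zero_iff, Finset.mem_univ,
    forall_true_left] at h
  refine ⟨fun j => ?_, fun j ε => (h ε j).1.2.2, fun j k hjk δ =>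
    ((h 1 j).2 δ k (by simp [hjk.symm])).2⟩
  simpa [sgn] using (h 1 j).1.2.1

/-- By the gauge property each shift term is V_j^ε times the change of the s-product. The constant C
carries everything that does not depend on the active variables. -/
theorem operatorH_kernel {c : ModelCase} {G : ℂ → ℂ → ℂ} (b : Branches c G) {N M : ℕ}
    {g : Fin (2 * c.rho + 2) → ℂ} {lam β : ℂ} (hβ : β.re ≠ 0) {x : Fin N → ℂ} {y : Fin M → ℂ}
    (hx : IsRegularPoint c g lam β x) (hxy : ∀ j k (δ : ℤˣ), c.s (x j + sgn δ * y k) ≠ 0) (C : ℂ) :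
    operatorH c g lam β b.sRoot (fun x' => C * (Psi b g lam β x' * kernelProduct c x' y)) x =
      c.kernelQuotient g lam β x y * (C * (Psi b g lam β x * kernelProduct c x y)) := by
  obtain ⟨κ, hκ, hγ⟩ := b.gRoot_shift β hβ
  have hγ' : ∀ z, b.sRoot z ≠ 0 → b.gRoot (z + I * β / 2) β =
      κ * b.sRoot z * b.gRoot (z - I * β / 2) β := fun z hz => hγ z (by
    rw [← b.sRoot_sq]; exact pow_ne_zero 2 hz)
  have hroot : ∀ {ε j} {x' : Fin N → ℂ}, coeffV c g lam β ε j x' ≠ 0 →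
      rootV c g lam β b.sRoot ε j x' ≠ 0 := fun h h0 => by
    rw [← rootV_sq b, h0] at h
    simp at h
  rw [operatorH, ModelCase.kernelQuotient, add_mul, mul_assoc (c.s _), Finset.sum_mul]
  congr 2
  refine Finset.sum_congr rfl fun ε _ => ?_
  rw [Finset.sum_mul]
  refine Finset.sum_congr rfl fun j _ => ?_
  have h := rootV_neg_mul_gammaProduct_shift hκ (γ := fun z => b.gRoot z β) hγ'
    (hroot (hx ε j).1) (hroot (hx ε j).2)
  rw [ModelCase.shiftTerm, ← rootV_sq b, kernelProduct_shift c x y β ε j hxy, Psi, Psi]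
  linear_combination C * rootV c g lam β b.sRoot ε j x * (∏ δ : ℤˣ, ∏ k,
      c.s (x j + sgn δ * y k - sgn ε * (I * β)) / c.s (x j + sgn δ * y k)) *
      kernelProduct c x y * h

end VanDiejen

open VanDiejen

theorem mainTheorem7 (c : ModelCase) (G : ℂ → ℂ → ℂ) (hG : IsGammaFunction c G)
    (b : Branches c G) (N M : ℕ) (g : Fin (2 * c.rho + 2) → ℂ) (lam : ℂ) (β : ℝ)
    (hβ : 0 < β) (hlam : lam.re ≠ 0)
    (hper : ∀ n : ℤ, n ≠ 0 → c.s (n * (I * β)) ≠ 0 ∧ c.s (n * (I * (lam * β))) ≠ 0)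
    (hconst : c.s (I * (1 - lam) * β) ≠ 0)
    (hbal : c.IsElliptic →
      2 * lam * ((N : ℂ) - 1) + 2 * ((M : ℂ) - 1) + ∑ ν, g ν = 0)
    (x : Fin N → ℂ) (y : Fin M → ℂ)
    (hx : IsRegularPoint c g lam β x)
    (hy : IsRegularPoint c (fun ν => g ν / lam) (1 / lam) (lam * β) y)
    (hxy : ∀ j k, c.s (x j + y k) ≠ 0 ∧ c.s (x j - y k) ≠ 0) :
    operatorH c g lam β b.sRoot (fun x' => dualKernel b g lam β x' y) x +
        operatorH c (fun ν => g ν / lam) (1 / lam) (lam * β) b.sRoot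
          (fun y' => dualKernel b g lam β x y') y -
        dualConstant c N M g lam β * dualKernel b g lam β x y = 0 := by
  have hlam0 : lam ≠ 0 := fun h => hlam (by simp [h])
  have hxy' : ∀ j k (δ : ℤˣ), c.s (x j + sgn δ * y k) ≠ 0 := by
    intro j k δ
    rcases Int.units_eq_one_or δ with rfl | rfl
    · simpa [sgn] using (hxy j k).1
    · simpa [sgn, sub_eq_add_neg] using (hxy j k).2
  have hyx' : ∀ k j (δ : ℤˣ), c.s (y k + sgn δ * x j) ≠ 0 := by
    intro k j δ
    rcases Int.units_eq_one_or δ with rfl | rfl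
    · simpa [sgn, add_comm] using (hxy j k).1
    · have := (hxy j k).2
      rw [c.s_sub_comm, neg_ne_zero] at this
      simpa [sgn, sub_eq_add_neg] using this
  have hb : c.IsElliptic → 2 * lam * N + 2 * M + ∑ ν, g ν - (c.rho + 1) * (lam + 1) / 2 = 0 := by
    intro hE
    have hr : (c.rho : ℂ) = 3 := by rw [c.rho_of_isElliptic hE]; norm_num
    linear_combination hbal hE - (lam + 1) / 2 * hr
  -- The assumption `hconst` also witnesses that s is not identically zero.
  have key := ModelCase.kernelQuotient_add ⟨_, hconst⟩ hlam0 hconst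
    (admissible_of_isRegularPoint hx) (admissible_of_isRegularPoint hy) hxy' hb
  have e1 : ∀ x' : Fin N → ℂ, dualKernel b g lam β x' y =
      Psi b (fun ν => g ν / lam) (1 / lam) (lam * β) y *
        (Psi b g lam β x' * kernelProduct c x' y) := fun x' => by
    rw [dualKernel, kernelProduct]
    ring
  have e2 : ∀ y' : Fin M → ℂ, dualKernel b g lam β x y' =
      (Psi b g lam β x * (-1) ^ (N * M)) *
        (Psi b (fun ν => g ν / lam) (1 / lam) (lam * β) y' * kernelProduct c y' x) := fun y' => by
    have := kernelProduct_comm c x y'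
    rw [kernelProduct] at this
    rw [dualKernel, this]
    ring
  have h1 := operatorH_kernel b (by simpa using hβ.ne') hx hxy'
    (Psi b (fun ν => g ν / lam) (1 / lam) (lam * β) y)
  have h2 := operatorH_kernel b (by simpa using ⟨hlam, hβ.ne'⟩) hy hyx'
    (Psi b g lam β x * (-1) ^ (N * M))
  simp only [← e1] at h1
  simp only [← e2] at h2
  rw [h1, h2, ← key]
  ring
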